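/- Let $n\ge 3$ be an integer, $\alpha\in(0,n)$, $\sigma_1,\sigma_2\in[0,\alpha)$, and $p,q>0$ with $pq>1$. Put $$p_0=\frac{\alpha(1+p)-(\sigma_2+\sigma_1p)}{pq-1},\qquad q_0=\frac{\alpha(1+q)-(\sigma_1+\sigma_2q)}{pq-1},\qquad r_0=\frac n{q_0},\qquad s_0=\frac n{p_0}.$$ Let $u,v:\mathbb{R}^n\to(0,\infty)$ satisfy, for every $x\in\mathbb{R}^n$, $$u(x)=\int_{\mathbb{R}^n}\frac{v(y)^q}{|x-y|^{n-\alpha}|y|^{\sigma_1}}\,dy,\qquad v(x)=\int_{\mathbb{R}^n}\frac{u(y)^p}{|x-y|^{n-\alpha}|y|^{\sigma_2}}\,dy,$$ and suppose that $u\in L^{r_0}(\mathbb{R}^n)$ and $v\in L^{s_0}(\mathbb{R}^n)$. Then there is a point $c\in\mathbb{R}^n$ such that $u$ and $v$ are both radially symmetric about $c$ and strictly decreasing in $|x-c|$. If $\sigma_1>0$ or $\sigma_2>0$, then $c$ is the origin. -/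

import Mathlib

open MeasureTheory

noncomputable section

namespace HardySobolev

/-- The exponent `p₀ = (α(1+p) - (σ₂ + σ₁ p)) / (pq - 1)`. -/
def p₀ (α p q σ₁ σ₂ : ℝ) : ℝ := (α * (1 + p) - (σ₂ + σ₁ * p)) / (p * q - 1)

/-- The exponent `q₀ = (α(1+q) - (σ₁ + σ₂ q)) / (pq - 1)`. -/
def q₀ (α p q σ₁ σ₂ : ℝ) : ℝ := (α * (1 + q) - (σ₁ + σ₂ * q)) / (p * q - 1)

/-- The integrand `y ↦ w(y)^m / (|x-y|^{n-α} |y|^σ)` of the weighted Riesz potential at `x`. -/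
def kernelIntegrand (n : ℕ) (α σ m : ℝ) (w : EuclideanSpace ℝ (Fin n) → ℝ)
    (x y : EuclideanSpace ℝ (Fin n)) : ℝ :=
  w y ^ m / (‖x - y‖ ^ ((n : ℝ) - α) * ‖y‖ ^ σ)

/-- `(u, v)` is a positive solution of the Hardy--Sobolev type system
`u(x) = ∫ v(y)^q / (|x-y|^{n-α} |y|^{σ₁}) dy`, `v(x) = ∫ u(y)^p / (|x-y|^{n-α} |y|^{σ₂}) dy`,
the integrals converging and the equations holding at every point `x` of `ℝⁿ`. -/
structure IsPositiveSolution (n : ℕ) (α p q σ₁ σ₂ : ℝ)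
    (u v : EuclideanSpace ℝ (Fin n) → ℝ) : Prop where
  pos_u : ∀ x, 0 < u x
  pos_v : ∀ x, 0 < v x
  integrable_u : ∀ x, Integrable (kernelIntegrand n α σ₁ q v x) volume
  eq_u : ∀ x, u x = ∫ y, kernelIntegrand n α σ₁ q v x y
  integrable_v : ∀ x, Integrable (kernelIntegrand n α σ₂ p u x) volume
  eq_v : ∀ x, v x = ∫ y, kernelIntegrand n α σ₂ p u x y

/-- A positive solution is integrable if `u ∈ L^{r₀}` and `v ∈ L^{s₀}`, where `r₀ = n / q₀` and
`s₀ = n / p₀`. -/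
structure IsPositiveIntegrableSolution (n : ℕ) (α p q σ₁ σ₂ : ℝ)
    (u v : EuclideanSpace ℝ (Fin n) → ℝ) : Prop
    extends IsPositiveSolution n α p q σ₁ σ₂ u v where
  memLp_u : MemLp u (ENNReal.ofReal ((n : ℝ) / q₀ α p q σ₁ σ₂)) volume
  memLp_v : MemLp v (ENNReal.ofReal ((n : ℝ) / p₀ α p q σ₁ σ₂)) volume

/-- `f` is radially symmetric about `c`: its value at `x` depends on `|x - c|` only. -/
def IsRadialAbout {n : ℕ} (c : EuclideanSpace ℝ (Fin n))
    (f : EuclideanSpace ℝ (Fin n) → ℝ) : Prop :=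
  ∀ x y, ‖x - c‖ = ‖y - c‖ → f x = f y

/-- `f` is (strictly) decreasing about `c`: it decreases as the distance to `c` increases. -/
def IsDecreasingAbout {n : ℕ} (c : EuclideanSpace ℝ (Fin n))
    (f : EuclideanSpace ℝ (Fin n) → ℝ) : Prop :=
  ∀ x y, ‖x - c‖ < ‖y - c‖ → f y < f x

end HardySobolev

end

open scoped ENNReal
open Filter Topology

namespace HardySobolev

/-! The proof is the method of moving planes in integral form. Write `U`, `V` for the solution as
`[0, ∞]`-valued functions, `a = q₀`, `b = p₀`, and compare `U`, `V` on the half-space `⟪x, e⟫ > l`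
with their reflections `U_l`, `V_l`. The kernel prefers points on the same side. If `l ≥ 0`, the
weights prefer the reflected point, while if a weight is trivial its exponent imposes no sign on
`l`.

The analytic core is `exists_small`: if `U` and `V` have little mass where they exceed their
reflections, they never exceed them. Since `pq > 1`, one may take `p ≥ 1` by swapping the equations.
A Minkowski-type argument (`rpow_diff_le`) bounds `(V^{1/p} - V_l^{1/p})₊` by the `1/p`-th power of
the potential of `(U - U_l)₊^p`, and Bernoulli's inequality with exponent `pq` (`diff_le`) bounds
`(U - U_l)₊` by the potential of `pq V^{q - 1/p} (V^{1/p} - V_l^{1/p})₊`. Comparing `V^{1/p}` rather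
than `V` allows `q < 1`. The scaling relations `a + α - σ₁ = qb` and `b + α - σ₂ = pa` make the
resulting estimate close in weak `L^{n/a}`, with a small factor. Only weak-type bounds for the
potential (`exists_weakBound_potential`) and weak Hölder (`WeakBound.mul`) are needed. The required
inequalities `a + α < n` and `b + α < n` follow from the decay of potentials and integrability
(`a_add_lt`).

Smallness holds for large `l`, so planes can start. They can continue past any position of strict
inequality, by dominated convergence. Lower semicontinuity of potentials replaces continuity
throughout. A single point of non-strict inequality forces a.e. equality of the weighted densities
(`ae_eq_of_potential_eq`). With a nontrivial weight and `l > 0` this is impossible, so planes reach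
the origin from every direction. With no weights it means symmetry. Each direction then has a unique
hyperplane of symmetry, since two would give a period, contradicting integrability, and all these
hyperplanes share a point. -/

/-- The distribution function of `f` is bounded by `s ↦ (A / s) ^ t`. -/
def WeakBound {X : Type*} [MeasureSpace X] (t A : ℝ) (f : X → ℝ≥0∞) : Prop :=
  ∀ s : ℝ, 0 < s → volume {x | ENNReal.ofReal s < f x} ≤ ENNReal.ofReal ((A / s) ^ t)

/-! ### Weak Lebesgue bounds: Hölder, Chebyshev and dyadic integration. -/

section Weak

variable {X : Type*} [MeasureSpace X] {t A : ℝ} {f g : X → ℝ≥0∞}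

theorem WeakBound.mono (h : WeakBound t A f) (hg : ∀ x, g x ≤ f x) : WeakBound t A g :=
  fun s hs => (measure_mono fun _ hx => lt_of_lt_of_le hx (hg _)).trans (h s hs)

theorem WeakBound.const_mul (h : WeakBound t A f) {c : ℝ} (hc : 0 < c) :
    WeakBound t (c * A) (fun x => ENNReal.ofReal c * f x) := by
  intro s hs
  have := h (s / c) (by positivity)
  rw [show A / (s / c) = c * A / s by field_simp] at this
  refine le_trans (measure_mono fun x hx => ?_) this
  simp only [Set.mem_ofPred_eq] at hx ⊢
  rw [ENNReal.ofReal_div_of_pos hc]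
  exact ENNReal.div_lt_of_lt_mul' hx

theorem WeakBound.rpow (h : WeakBound t A f) (hA : 0 < A) {β : ℝ} (hβ : 0 < β) :
    WeakBound (t / β) (A ^ β) (fun x => f x ^ β) := by
  intro s hs
  have := h (s ^ (1 / β)) (by positivity)
  have e : (A / s ^ (1 / β)) ^ t = (A ^ β / s) ^ (t / β) := by
    rw [show t = β * (t / β) by field_simp, Real.rpow_mul (by positivity),
      Real.div_rpow hA.le (by positivity), ← Real.rpow_mul hs.le]
    congr 2
    · rw [one_div, inv_mul_cancel₀ hβ.ne', Real.rpow_one]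
    · field_simp
  rw [e] at this
  refine le_trans (measure_mono fun x hx => ?_) this
  simp only [Set.mem_ofPred_eq] at hx ⊢
  rw [← ENNReal.ofReal_rpow_of_pos hs, one_div]
  exact (ENNReal.rpow_inv_lt_iff hβ).2 hx

theorem WeakBound.of_subset_union {t B : ℝ} {f₁ f₂ : X → ℝ≥0∞} (ht : 0 < t) (hA : 0 < A)
    (h₁ : WeakBound t A f₁) (h₂ : WeakBound t A f₂) (hf : ∀ x, f x ≤ max (f₁ x) (f₂ x))
    (hB : B = 2 ^ (1 / t) * A) : WeakBound t B f := by
  intro s hs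
  have e : (B / s) ^ t = (A / s) ^ t + (A / s) ^ t := by
    rw [hB, mul_div_assoc, Real.mul_rpow (by positivity) (by positivity), ← Real.rpow_mul two_pos.le]
    rw [one_div, inv_mul_cancel₀ ht.ne', Real.rpow_one]; ring
  rw [e, ENNReal.ofReal_add (by positivity) (by positivity)]
  refine le_trans (measure_mono (t := {x | ENNReal.ofReal s < f₁ x} ∪ {x | ENNReal.ofReal s < f₂ x})
    fun x hx => ?_) ((measure_union_le _ _).trans (add_le_add (h₁ s hs) (h₂ s hs)))
  exact lt_max_iff.1 (lt_of_lt_of_le hx (hf x))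

/-- Weak Hölder inequality: where `f * g > s`, either `f > θ` or `g > s / θ`. -/
theorem WeakBound.mul {a b B : ℝ} (ha : 0 < a) (hb : 0 < b) (hA : 0 < A) (hB : 0 < B)
    (hf : WeakBound a A f) (hg : WeakBound b B g) (ht : 0 < t) (h : 1 / t = 1 / a + 1 / b) :
    WeakBound t (2 ^ (1 / t) * (A * B)) (fun x => f x * g x) := by
  intro s hs
  set z : ℝ := A * B / s with hz
  have hz0 : 0 < z := by positivity
  -- This threshold gives both level sets the same bound `z ^ t`.
  set θ : ℝ := A * z ^ (-(t / a)) with hθ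
  have hθ0 : 0 < θ := by positivity
  have hzz : z ^ (t / a) * z ^ (t / b) = z := by
    rw [← Real.rpow_add hz0, show t / a + t / b = 1 by
      have : t / a + t / b = t * (1 / a + 1 / b) := by ring
      rw [this, ← h]; field_simp, Real.rpow_one]
  have e1 : (A / θ) ^ a = z ^ t := by
    rw [hθ, Real.rpow_neg hz0.le, show A / (A * (z ^ (t / a))⁻¹) = z ^ (t / a) by field_simp,
      ← Real.rpow_mul hz0.le]
    congr 1; field_simp
  have e2 : (B / (s / θ)) ^ b = z ^ t := by
    have : B / (s / θ) = z ^ (t / b) := by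
      rw [hθ, Real.rpow_neg hz0.le]
      have h1 : B / (s / (A * (z ^ (t / a))⁻¹)) = z * (z ^ (t / a))⁻¹ := by
        rw [hz]; field_simp
      rw [h1]; nth_rewrite 1 [← hzz]; field_simp
    rw [this, ← Real.rpow_mul hz0.le]; congr 1; field_simp
  have e : (2 ^ (1 / t) * (A * B) / s) ^ t = z ^ t + z ^ t := by
    rw [mul_div_assoc, Real.mul_rpow (by positivity) hz0.le, ← Real.rpow_mul two_pos.le]
    rw [one_div, inv_mul_cancel₀ ht.ne', Real.rpow_one]; ring
  rw [e, ENNReal.ofReal_add (by positivity) (by positivity)]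
  have h1 := hf θ hθ0
  have h2 := hg (s / θ) (by positivity)
  rw [e1] at h1
  rw [e2] at h2
  refine le_trans (measure_mono
    (t := {x | ENNReal.ofReal θ < f x} ∪ {x | ENNReal.ofReal (s / θ) < g x})
    fun x hx => ?_) ((measure_union_le _ _).trans (add_le_add h1 h2))
  by_contra hcon
  simp only [Set.mem_union, Set.mem_ofPred_eq, not_or, not_lt] at hcon hx
  refine absurd hx (not_lt.2 ((mul_le_mul' hcon.1 hcon.2).trans ?_))
  rw [← ENNReal.ofReal_mul hθ0.le, mul_div_cancel₀ _ hθ0.ne']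

theorem WeakBound.of_lintegral_rpow_le (hf : AEMeasurable f) (ht : 0 < t) (hA : 0 < A)
    (h : ∫⁻ x, f x ^ t ≤ ENNReal.ofReal (A ^ t)) : WeakBound t A f := by
  intro s hs
  have h1 := mul_meas_ge_le_lintegral₀ (hf.pow_const t) (ENNReal.ofReal s ^ t)
  rw [ENNReal.ofReal_rpow_of_pos hs] at h1
  rw [Real.div_rpow hA.le hs.le, ENNReal.ofReal_div_of_pos (by positivity)]
  rw [ENNReal.le_div_iff_mul_le (Or.inl (by positivity)) (Or.inl ENNReal.ofReal_ne_top), mul_comm]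
  refine le_trans (mul_le_mul_right (measure_mono fun x hx => ?_) _) (h1.trans h)
  simp only [Set.mem_ofPred_eq] at hx ⊢
  rw [← ENNReal.ofReal_rpow_of_pos hs]
  exact ENNReal.rpow_le_rpow hx.le ht.le

theorem tsum_ofReal_geometric {a r : ℝ} (ha : 0 ≤ a) (hr : 0 ≤ r) (hr1 : r < 1) :
    ∑' j : ℕ, ENNReal.ofReal (a * r ^ j) = ENNReal.ofReal (a * (1 - r)⁻¹) := by
  rw [← ENNReal.ofReal_tsum_of_nonneg (fun j => by positivity)
    ((summable_geometric_of_lt_one hr hr1).mul_left a), tsum_mul_left,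
    tsum_geometric_of_lt_one hr hr1]

theorem le_add_tsum_dyadic (a : ℝ≥0∞) {h : ℝ} (hh : 0 < h) :
    a ≤ ENNReal.ofReal h + ∑' j : ℕ,
      {b : ℝ≥0∞ | ENNReal.ofReal (2 ^ j * h) < b}.indicator
        (fun _ => ENNReal.ofReal (2 ^ (j + 1) * h)) a := by
  by_cases hta : a = ∞
  · subst hta
    refine le_add_left ?_
    refine (ENNReal.tsum_const_eq_top_of_ne_zero (α := ℕ)
      (c := ENNReal.ofReal h) (by simpa using hh)).ge.trans ?_
    refine ENNReal.tsum_le_tsum fun j => ?_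
    rw [Set.indicator_of_mem (Set.mem_ofPred_eq ▸ ENNReal.ofReal_lt_top)]
    refine ENNReal.ofReal_le_ofReal ?_
    have : (1 : ℝ) ≤ 2 ^ (j + 1) := one_le_pow₀ (by norm_num)
    nlinarith
  · obtain ⟨r, hr, rfl⟩ : ∃ r : ℝ, 0 ≤ r ∧ a = ENNReal.ofReal r :=
      ⟨a.toReal, ENNReal.toReal_nonneg, (ENNReal.ofReal_toReal hta).symm⟩
    by_cases hrh : r ≤ h
    · exact le_add_right (ENNReal.ofReal_le_ofReal hrh)
    · push Not at hrh
      obtain ⟨j, hj1, hj2⟩ : ∃ j : ℕ, 2 ^ j * h < r ∧ r ≤ 2 ^ (j + 1) * h := by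
        have hex : ∃ N : ℕ, r ≤ 2 ^ N * h := by
          obtain ⟨N, hN⟩ := pow_unbounded_of_one_lt (r / h) (one_lt_two (α := ℝ))
          exact ⟨N, ((div_lt_iff₀ hh).1 hN).le⟩
        classical
        have hs := Nat.find_spec hex
        have hpos : Nat.find hex ≠ 0 := by
          intro h0; rw [h0] at hs; simp at hs; linarith
        obtain ⟨m, hm⟩ := Nat.exists_eq_succ_of_ne_zero hpos
        refine ⟨m, ?_, by rw [hm] at hs; exact hs⟩
        have := Nat.find_min hex (m := m) (by omega)
        linarith [not_le.1 this]
      refine le_add_left (le_trans ?_ (ENNReal.le_tsum j))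
      rw [Set.indicator_of_mem]
      · exact ENNReal.ofReal_le_ofReal hj2
      · exact (ENNReal.ofReal_lt_ofReal_iff (lt_trans (by positivity) hj1)).2 hj1

/-- Below a height `h` the integrand costs at most `h * M`. Above it, the dyadic layers contribute a
geometric series of ratio `2 ^ (1 - t)`, convergent since `t > 1`. -/
theorem exists_setLIntegral_le_of_weakBound (ht : 1 < t) :
    ∃ C : ℝ, 0 < C ∧ ∀ {A M : ℝ} {f : X → ℝ≥0∞} {S : Set X}, 0 < A → 0 < M → Measurable f →
      WeakBound t A f → volume S ≤ ENNReal.ofReal M →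
      ∫⁻ x in S, f x ≤ ENNReal.ofReal (C * A * M ^ (1 - 1 / t)) := by
  have hr1 : (2 : ℝ) ^ (1 - t) < 1 := Real.rpow_lt_one_of_one_lt_of_neg one_lt_two (by linarith)
  refine ⟨1 + 2 * (1 - (2 : ℝ) ^ (1 - t))⁻¹, ?_, ?_⟩
  · have : 0 < (1 - (2 : ℝ) ^ (1 - t))⁻¹ := inv_pos.2 (by linarith)
    positivity
  intro A M f S hA hM hf hw hS
  -- At this height the weak bound on the level set equals the given volume bound `M`.
  set h : ℝ := A * M ^ (-(1 / t)) with hh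
  have hh0 : 0 < h := by positivity
  have hAM : h * M = A * M ^ (1 - 1 / t) := by
    rw [hh, sub_eq_neg_add, Real.rpow_add hM, Real.rpow_one]; ring
  have hAh : (A / h) ^ t = M := by
    rw [hh, Real.rpow_neg hM.le, show A / (A * (M ^ (1 / t))⁻¹) = M ^ (1 / t) by field_simp,
      ← Real.rpow_mul hM.le, one_div, inv_mul_cancel₀ (by linarith), Real.rpow_one]
  have hms : ∀ j : ℕ, MeasurableSet {x | ENNReal.ofReal (2 ^ j * h) < f x} := fun j =>
    measurableSet_lt measurable_const hf
  calc ∫⁻ x in S, f x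
      ≤ ∫⁻ x in S, (ENNReal.ofReal h + ∑' j : ℕ,
          {x | ENNReal.ofReal (2 ^ j * h) < f x}.indicator
            (fun _ => ENNReal.ofReal (2 ^ (j + 1) * h)) x) :=
        lintegral_mono fun x => le_add_tsum_dyadic (f x) hh0
    _ = ENNReal.ofReal h * volume S + ∑' j : ℕ, ENNReal.ofReal (2 ^ (j + 1) * h) *
          (volume.restrict S) {x | ENNReal.ofReal (2 ^ j * h) < f x} := by
        rw [lintegral_add_left measurable_const, setLIntegral_const, lintegral_tsum]
        · congr 2; ext j; rw [lintegral_indicator_const (hms j)]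
        · exact fun j => (measurable_const.indicator (hms j)).aemeasurable
    _ ≤ ENNReal.ofReal (h * M) + ∑' j : ℕ, ENNReal.ofReal (2 * (h * M) * ((2 : ℝ) ^ (1 - t)) ^ j) := by
        gcongr with j
        · rw [ENNReal.ofReal_mul hh0.le]; gcongr
        · refine (mul_le_mul_right ((Measure.restrict_apply_le _ _).trans
            (hw (2 ^ j * h) (by positivity))) _).trans ?_
          rw [← ENNReal.ofReal_mul (by positivity)]
          refine ENNReal.ofReal_le_ofReal (le_of_eq ?_)
          rw [mul_comm (2 ^ j) h, ← div_div, Real.div_rpow (by positivity) (by positivity), hAh,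
            ← Real.rpow_natCast ((2 : ℝ) ^ (1 - t)), ← Real.rpow_mul two_pos.le, sub_mul, one_mul,
            Real.rpow_sub two_pos, ← Real.rpow_natCast (2 : ℝ) j, ← Real.rpow_mul two_pos.le,
            pow_succ, mul_comm t, ← Real.rpow_natCast (2 : ℝ) j]
          field_simp
    _ = _ := by
        rw [tsum_ofReal_geometric (by positivity) (by positivity) hr1, ← ENNReal.ofReal_add
          (by positivity) (mul_nonneg (by positivity) (inv_nonneg.2 (by linarith))), mul_assoc _ A,
          ← hAM]
        congr 1; ring

theorem le_tsum_dyadic {a : ℝ≥0∞} {h : ℝ} (ha : a ≤ ENNReal.ofReal h) :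
    a ≤ ∑' j : ℕ,
      {b : ℝ≥0∞ | ENNReal.ofReal (h / 2 ^ (j + 1)) < b}.indicator
        (fun _ => ENNReal.ofReal (h / 2 ^ j)) a := by
  obtain ⟨r, hr, rfl⟩ : ∃ r : ℝ, 0 ≤ r ∧ a = ENNReal.ofReal r :=
    ⟨a.toReal, ENNReal.toReal_nonneg,
      (ENNReal.ofReal_toReal (ne_top_of_le_ne_top ENNReal.ofReal_ne_top ha)).symm⟩
  rcases hr.eq_or_lt with rfl | hr
  · simp
  have hrh : r ≤ h := by
    by_contra hc
    push Not at hc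
    exact absurd ha (not_le.2 ((ENNReal.ofReal_lt_ofReal_iff hr).2 hc))
  obtain ⟨j, hj1, hj2⟩ : ∃ j : ℕ, h / 2 ^ (j + 1) < r ∧ r ≤ h / 2 ^ j := by
    have hex : ∃ N : ℕ, h / 2 ^ N < r := by
      obtain ⟨N, hN⟩ := pow_unbounded_of_one_lt (h / r) (one_lt_two (α := ℝ))
      exact ⟨N, (div_lt_comm₀ hr (by positivity)).1 hN⟩
    classical
    have hs := Nat.find_spec hex
    have hpos : Nat.find hex ≠ 0 := by
      intro h0; rw [h0] at hs; simp at hs; linarith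
    obtain ⟨m, hm⟩ := Nat.exists_eq_succ_of_ne_zero hpos
    refine ⟨m, by rw [hm] at hs; exact hs, ?_⟩
    exact not_lt.1 (Nat.find_min hex (m := m) (by omega))
  refine le_trans ?_ (ENNReal.le_tsum j)
  rw [Set.indicator_of_mem]
  · exact ENNReal.ofReal_le_ofReal hj2
  · exact (ENNReal.ofReal_lt_ofReal_iff hr).2 hj1

/-- This treats the low part of `f` in a potential with kernel `k`. Slice `f` dyadically downwards
from `h` and integrate `k` over each superlevel set with the preceding estimate. The condition `t *
(1 - 1 / κ) < 1` makes the slices summable. -/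
theorem exists_setLIntegral_mul_le_of_weakBound {κ : ℝ} (hκ : 1 < κ)
    (htκ : t * (1 - 1 / κ) < 1) :
    ∃ C : ℝ, 0 < C ∧ ∀ {A h : ℝ} {f k : X → ℝ≥0∞}, 0 < A → 0 < h → Measurable f → Measurable k →
      WeakBound t 1 f → WeakBound κ A k →
      ∫⁻ x in {x | f x ≤ ENNReal.ofReal h}, k x * f x ≤
        ENNReal.ofReal (C * A * h ^ (1 - t * (1 - 1 / κ))) := by
  obtain ⟨C, hC, hCb⟩ := exists_setLIntegral_le_of_weakBound (X := X) hκ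
  set τ := t * (1 - 1 / κ) with hτ
  have hr1 : (2 : ℝ) ^ (τ - 1) < 1 := Real.rpow_lt_one_of_one_lt_of_neg one_lt_two (by linarith)
  refine ⟨C * 2 ^ τ * (1 - (2 : ℝ) ^ (τ - 1))⁻¹, ?_, ?_⟩
  · have : 0 < (1 - (2 : ℝ) ^ (τ - 1))⁻¹ := inv_pos.2 (by linarith)
    positivity
  intro A h f k hA hh hf hk hwf hwk
  have hms : ∀ j : ℕ, MeasurableSet {x | ENNReal.ofReal (h / 2 ^ (j + 1)) < f x} := fun j =>
    measurableSet_lt measurable_const hf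
  have hle : ∀ x, f x ≤ ENNReal.ofReal h → k x * f x ≤ ∑' j : ℕ,
      {x | ENNReal.ofReal (h / 2 ^ (j + 1)) < f x}.indicator
        (fun x => ENNReal.ofReal (h / 2 ^ j) * k x) x := by
    intro x hx
    refine (mul_le_mul_right (le_tsum_dyadic hx) _).trans (le_of_eq ?_)
    rw [← ENNReal.tsum_mul_left]
    congr 1; ext j
    by_cases hj : ENNReal.ofReal (h / 2 ^ (j + 1)) < f x
    · rw [Set.indicator_of_mem (by exact hj), Set.indicator_of_mem (by exact hj), mul_comm]
    · rw [Set.indicator_of_notMem (by exact hj), Set.indicator_of_notMem (by exact hj), mul_zero]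
  calc ∫⁻ x in {x | f x ≤ ENNReal.ofReal h}, k x * f x
      ≤ ∫⁻ x in {x | f x ≤ ENNReal.ofReal h}, ∑' j : ℕ,
      {x | ENNReal.ofReal (h / 2 ^ (j + 1)) < f x}.indicator
        (fun x => ENNReal.ofReal (h / 2 ^ j) * k x) x :=
        setLIntegral_mono' (measurableSet_le hf measurable_const) fun x hx => hle x hx
    _ ≤ ∫⁻ x, ∑' j : ℕ, {x | ENNReal.ofReal (h / 2 ^ (j + 1)) < f x}.indicator
        (fun x => ENNReal.ofReal (h / 2 ^ j) * k x) x := setLIntegral_le_lintegral _ _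
    _ = ∑' j : ℕ, ENNReal.ofReal (h / 2 ^ j) *
          ∫⁻ x in {x | ENNReal.ofReal (h / 2 ^ (j + 1)) < f x}, k x := by
        rw [lintegral_tsum]
        · congr 1; ext j
          rw [lintegral_indicator (hms j), lintegral_const_mul _ hk]
        · exact fun j => ((hk.const_mul _).indicator (hms j)).aemeasurable
    _ ≤ ∑' j : ℕ, ENNReal.ofReal (C * A * 2 ^ τ * h ^ (1 - τ) * ((2 : ℝ) ^ (τ - 1)) ^ j) := by
        gcongr with j
        refine (mul_le_mul_right (hCb hA (M := (1 / (h / 2 ^ (j + 1))) ^ t) (by positivity) hk hwk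
          (hwf _ (by positivity))) _).trans ?_
        rw [← ENNReal.ofReal_mul (by positivity)]
        refine ENNReal.ofReal_le_ofReal (le_of_eq ?_)
        rw [← Real.rpow_mul (by positivity), ← hτ, one_div, inv_div,
          Real.div_rpow (by positivity) hh.le, ← Real.rpow_natCast ((2 : ℝ) ^ (τ - 1)),
          ← Real.rpow_mul two_pos.le, sub_mul, one_mul, Real.rpow_sub two_pos, Real.rpow_sub hh,
          Real.rpow_one, ← Real.rpow_natCast (2 : ℝ) (j + 1), ← Real.rpow_mul two_pos.le,
          ← Real.rpow_natCast (2 : ℝ) j]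
        push_cast
        rw [add_mul, one_mul, Real.rpow_add two_pos, mul_comm τ]
        field_simp
    _ = _ := by
        rw [tsum_ofReal_geometric (by positivity) (by positivity) hr1]
        congr 1; ring

end Weak

/-! ### Weak-type bounds for the weighted Riesz potential. -/

/-- The weight `z ↦ ‖z‖⁻ᵃ`, with values in `[0, ∞]`. -/
noncomputable def wt {n : ℕ} (a : ℝ) (z : EuclideanSpace ℝ (Fin n)) : ℝ≥0∞ :=
  ENNReal.ofReal ((‖z‖ ^ a)⁻¹)

/-- The weighted Riesz potential `x ↦ ∫ f(y) ‖x - y‖^{α - n} ‖y‖^{-σ} dy`. -/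
noncomputable def potential {n : ℕ} (α σ : ℝ) (f : EuclideanSpace ℝ (Fin n) → ℝ≥0∞)
    (x : EuclideanSpace ℝ (Fin n)) : ℝ≥0∞ :=
  ∫⁻ y, wt ((n : ℝ) - α) (x - y) * wt σ y * f y

section Potential

variable {n : ℕ}

@[fun_prop]
theorem measurable_wt (a : ℝ) : Measurable (wt a : EuclideanSpace ℝ (Fin n) → ℝ≥0∞) := by
  unfold wt; fun_prop

theorem wt_sub_comm (a : ℝ) (x y : EuclideanSpace ℝ (Fin n)) : wt a (x - y) = wt a (y - x) := by
  simp only [wt, norm_sub_rev]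

theorem wt_zero (z : EuclideanSpace ℝ (Fin n)) : wt 0 z = 1 := by simp [wt]

theorem exists_volume_ball_le [NeZero n] : ∃ ω : ℝ, 0 < ω ∧
    ∀ (x : EuclideanSpace ℝ (Fin n)) (r : ℝ), 0 ≤ r →
      volume (Metric.ball x r) = ENNReal.ofReal (ω * r ^ (n : ℝ)) := by
  refine ⟨(volume (Metric.ball (0 : EuclideanSpace ℝ (Fin n)) 1)).toReal,
    ENNReal.toReal_pos (Metric.measure_ball_pos _ _ one_pos).ne' measure_ball_lt_top.ne, ?_⟩
  intro x r hr
  rw [Measure.addHaar_ball _ _ hr, ENNReal.ofReal_mul (by positivity),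
    ENNReal.ofReal_toReal measure_ball_lt_top.ne, mul_comm]
  simp

theorem exists_weakBound_wt [NeZero n] {a : ℝ} (ha : 0 < a) : ∃ A : ℝ, 0 < A ∧
    ∀ x : EuclideanSpace ℝ (Fin n), WeakBound (n / a) A (fun y => wt a (x - y)) := by
  obtain ⟨ω, hω, hb⟩ := exists_volume_ball_le (n := n)
  have hn : (0 : ℝ) < n := by exact_mod_cast Nat.pos_of_ne_zero (NeZero.ne n)
  refine ⟨ω ^ (a / n), by positivity, fun x s hs => ?_⟩
  have e : ω * (s ^ (-(1 / a))) ^ (n : ℝ) = (ω ^ (a / n) / s) ^ (n / a) := by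
    rw [Real.div_rpow (by positivity) hs.le, ← Real.rpow_mul hω.le, ← Real.rpow_mul hs.le,
      show a / n * (n / a) = 1 by field_simp, Real.rpow_one,
      show -(1 / a) * (n : ℝ) = -(n / a) by ring, Real.rpow_neg hs.le]
    rfl
  rw [← e, ← hb x _ (by positivity)]
  refine measure_mono fun y hy => ?_
  simp only [Set.mem_ofPred_eq, wt] at hy
  rw [ENNReal.ofReal_lt_ofReal_iff_of_nonneg hs.le] at hy
  rw [Metric.mem_ball, dist_comm, dist_eq_norm]
  set r := ‖x - y‖
  have hr : 0 < r := by
    rcases (norm_nonneg (x - y)).eq_or_lt with h | h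
    · exfalso
      have : r = 0 := h.symm
      rw [this, Real.zero_rpow ha.ne'] at hy
      simp at hy; linarith
    · exact h
  have h2 : r ^ a < s⁻¹ := by
    rw [lt_inv_comm₀ hs (by positivity)] at hy; exact hy
  have h3 := Real.rpow_lt_rpow (by positivity) h2 (one_div_pos.2 ha)
  rwa [← Real.rpow_mul hr.le, mul_one_div_cancel ha.ne', Real.rpow_one, Real.inv_rpow hs.le,
    ← Real.rpow_neg hs.le] at h3

theorem exists_setLIntegral_ball_wt_le [NeZero n] {α : ℝ} (hα : 0 < α) (hαn : α < n) :
    ∃ C : ℝ, 0 < C ∧ ∀ (y : EuclideanSpace ℝ (Fin n)) (ρ : ℝ), 0 < ρ →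
      ∫⁻ x in Metric.ball y ρ, wt (n - α) (x - y) ≤ ENNReal.ofReal (C * ρ ^ α) := by
  obtain ⟨ω, hω, hb⟩ := exists_volume_ball_le (n := n)
  have hn : (0 : ℝ) < n := hα.trans hαn
  have hnα : (0 : ℝ) < n - α := by linarith
  obtain ⟨A, hA, hwA⟩ := exists_weakBound_wt (n := n) hnα
  obtain ⟨C, hC, hCb⟩ := exists_setLIntegral_le_of_weakBound (X := EuclideanSpace ℝ (Fin n))
    (t := n / (n - α)) (by rw [one_lt_div hnα]; linarith)
  refine ⟨C * A * ω ^ (α / n), by positivity, fun y ρ hρ => ?_⟩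
  have := hCb (A := A) (M := ω * ρ ^ (n : ℝ)) (f := fun x => wt (n - α) (y - x))
    (S := Metric.ball y ρ) hA (by positivity) (by fun_prop) (hwA y) (hb y ρ hρ.le).le
  simp only [wt_sub_comm _ y] at this
  refine this.trans (ENNReal.ofReal_le_ofReal (le_of_eq ?_))
  rw [show 1 - 1 / ((n : ℝ) / (n - α)) = α / n by field_simp; ring,
    Real.mul_rpow hω.le (by positivity), ← Real.rpow_mul hρ.le,
    show (n : ℝ) * (α / n) = α by field_simp]
  ring

/-- Replace the larger of the two distances by the smaller. This makes the weak bound on the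
two-factor kernel uniform in `x`. -/
theorem wt_mul_wt_le_max {a σ : ℝ} (ha : 0 < a) (hσ : 0 ≤ σ) (x y : EuclideanSpace ℝ (Fin n)) :
    wt a (x - y) * wt σ y ≤ max (wt (a + σ) (x - y)) (wt (a + σ) (0 - y)) := by
  unfold wt
  rw [zero_sub, norm_neg, ← ENNReal.ofReal_mul (by positivity), ← ENNReal.ofReal_max]
  refine ENNReal.ofReal_le_ofReal ?_
  rcases (norm_nonneg (x - y)).eq_or_lt with h | h
  · rw [← h, Real.zero_rpow ha.ne', inv_zero, zero_mul]
    exact le_max_of_le_left (by positivity)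
  rcases (norm_nonneg y).eq_or_lt with h' | h'
  · rcases hσ.eq_or_lt with rfl | hσ
    · simp
    · rw [← h', Real.zero_rpow hσ.ne', inv_zero, mul_zero]
      exact le_max_of_le_left (by positivity)
  rw [← mul_inv]
  rcases le_total ‖x - y‖ ‖y‖ with hle | hle
  · refine le_max_of_le_left (inv_anti₀ (by positivity) ?_)
    rw [Real.rpow_add h]
    gcongr
  · refine le_max_of_le_right (inv_anti₀ (by positivity) ?_)
    rw [Real.rpow_add h']
    gcongr

theorem exists_weakBound_kernel [NeZero n] {a σ : ℝ} (ha : 0 < a) (hσ : 0 ≤ σ) :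
    ∃ A : ℝ, 0 < A ∧ ∀ x : EuclideanSpace ℝ (Fin n),
      WeakBound (n / (a + σ)) A (fun y => wt a (x - y) * wt σ y) := by
  have hn : (0 : ℝ) < n := by exact_mod_cast Nat.pos_of_ne_zero (NeZero.ne n)
  obtain ⟨A, hA, hwA⟩ := exists_weakBound_wt (n := n) (a := a + σ) (by positivity)
  exact ⟨_, by positivity, fun x => WeakBound.of_subset_union (by positivity) hA (hwA x) (hwA 0)
    (fun y => wt_mul_wt_le_max ha hσ x y) rfl⟩

theorem exists_weakBound_wt_mul [NeZero n] {t t' σ : ℝ} (ht : 0 < t) (ht' : 0 < t') (hσ : 0 ≤ σ)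
    (h : 1 / t' = 1 / t + σ / n) :
    ∃ A : ℝ, 0 < A ∧ ∀ f : EuclideanSpace ℝ (Fin n) → ℝ≥0∞, WeakBound t 1 f →
      WeakBound t' A (fun y => wt σ y * f y) := by
  have hn : (0 : ℝ) < n := by exact_mod_cast Nat.pos_of_ne_zero (NeZero.ne n)
  rcases hσ.eq_or_lt with rfl | hσ
  · refine ⟨1, one_pos, fun f hf => ?_⟩
    have : t' = t := by simpa using h
    subst this
    simpa [wt_zero] using hf
  · obtain ⟨A, hA, hwA⟩ := exists_weakBound_wt (n := n) hσ
    refine ⟨_, by positivity, fun f hf => WeakBound.mul (A := A) (a := n / σ) (by positivity) ht hA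
      one_pos ?_ hf ht' (by rw [h]; field_simp; ring)⟩
    refine (hwA 0).mono fun y => ?_
    rw [wt_sub_comm, sub_zero]

theorem setLIntegral_inter_ball_eq (a σ ρ : ℝ) (f : EuclideanSpace ℝ (Fin n) → ℝ≥0∞)
    (S : Set (EuclideanSpace ℝ (Fin n))) (x : EuclideanSpace ℝ (Fin n)) :
    ∫⁻ y in S ∩ Metric.ball x ρ, wt a (x - y) * wt σ y * f y =
      ∫⁻ y in S, {p : EuclideanSpace ℝ (Fin n) × EuclideanSpace ℝ (Fin n) |
        dist p.2 p.1 < ρ}.indicator (fun p => wt a (p.1 - p.2) * wt σ p.2 * f p.2) (x, y) := by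
  rw [Set.inter_comm, ← Measure.restrict_restrict measurableSet_ball,
    ← lintegral_indicator measurableSet_ball]
  rfl

/-- Tonelli: the near part of the kernel is integrated in `x` first. -/
theorem lintegral_near_le {α σ ρ C : ℝ} (f : EuclideanSpace ℝ (Fin n) → ℝ≥0∞)
    (hf : Measurable f) {S : Set (EuclideanSpace ℝ (Fin n))}
    (hC : ∀ y : EuclideanSpace ℝ (Fin n),
      ∫⁻ x in Metric.ball y ρ, wt (n - α) (x - y) ≤ ENNReal.ofReal C) :
    ∫⁻ x, ∫⁻ y in S ∩ Metric.ball x ρ, wt (n - α) (x - y) * wt σ y * f y ≤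
      ENNReal.ofReal C * ∫⁻ y in S, wt σ y * f y := by
  have hm : MeasurableSet {p : EuclideanSpace ℝ (Fin n) × EuclideanSpace ℝ (Fin n) |
      dist p.2 p.1 < ρ} := measurableSet_lt (by fun_prop) measurable_const
  simp_rw [setLIntegral_inter_ball_eq]
  rw [lintegral_lintegral_swap, ← lintegral_const_mul _ (by fun_prop)]
  · refine lintegral_mono fun y => ?_
    calc _ = ∫⁻ x in Metric.ball y ρ, wt (n - α) (x - y) * (wt σ y * f y) := by
          rw [← lintegral_indicator measurableSet_ball]
          refine lintegral_congr fun x => ?_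
          simp only [Set.indicator, Metric.mem_ball, Set.mem_ofPred_eq, dist_comm x y, mul_assoc]
      _ ≤ _ := by
          rw [lintegral_mul_const _ (by fun_prop)]
          gcongr
          exact hC y
  · refine Measurable.aemeasurable ?_
    exact Measurable.indicator (by fun_prop) hm

/-- Split `f` at a height `h` and the kernel at a radius `ρ`. The low part of `f`, and the high part
seen from distance at least `ρ`, are bounded pointwise by multiples of `ρ ^ (-β)`. The high part
seen from nearby is bounded in `L¹`, and Chebyshev finishes. Positivity of `β` controls the low
part, and `β + α < n` makes the weighted high part integrable. -/
theorem exists_weakBound_potential_of_one [NeZero n] {α σ β : ℝ} (hα : 0 < α) (hαn : α < n)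
    (hσ : 0 ≤ σ) (hσα : σ < α) (hβ : 0 < β) (hβα : β + α < n) :
    ∃ C : ℝ, 0 < C ∧ ∀ f : EuclideanSpace ℝ (Fin n) → ℝ≥0∞, Measurable f →
      WeakBound (n / (β + α - σ)) 1 f → WeakBound (n / β) C (potential α σ f) := by
  have hn : (0 : ℝ) < n := hα.trans hαn
  have hnα : (0 : ℝ) < n - α := by linarith
  have hγ : 0 < β + α - σ := by linarith
  obtain ⟨A, hA, hwA⟩ := exists_weakBound_kernel (n := n) hnα hσ
  obtain ⟨A', hA', hwA'⟩ := exists_weakBound_wt_mul (n := n) (t := n / (β + α - σ))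
    (t' := n / (β + α)) (by positivity) (by positivity) hσ (by field_simp; ring)
  obtain ⟨C₁, hC₁, hb₁⟩ := exists_setLIntegral_mul_le_of_weakBound
    (X := EuclideanSpace ℝ (Fin n)) (t := n / (β + α - σ)) (κ := n / (n - α + σ))
    (by rw [one_lt_div (by positivity)]; linarith)
    (by rw [one_div_div, div_mul_eq_mul_div, div_lt_one hγ]; field_simp; linarith)
  obtain ⟨C₂, hC₂, hb₂⟩ := exists_setLIntegral_le_of_weakBound
    (X := EuclideanSpace ℝ (Fin n)) (t := n / (β + α)) (by rw [one_lt_div (by positivity)]; linarith)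
  obtain ⟨C₃, hC₃, hb₃⟩ := exists_setLIntegral_ball_wt_le (n := n) hα hαn
  -- The extra `1` leaves a margin `ρ ^ (-β)` that the near part `N` must exceed when the potential
  -- exceeds `s`.
  set K : ℝ := C₁ * A + C₂ * A' + 1 with hK
  have hK0 : 0 < K := by positivity
  set M : ℝ := C₃ * (C₂ * A') with hM
  have hM0 : 0 < M := by positivity
  refine ⟨K * M ^ (β / n), by positivity, fun f hf hw s hs => ?_⟩
  obtain ⟨ρ, hρ, hsρ⟩ : ∃ ρ : ℝ, 0 < ρ ∧ s = K * ρ ^ (-β) := by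
    refine ⟨(s / K) ^ (-(1 / β)), by positivity, ?_⟩
    rw [← Real.rpow_mul (by positivity), show -(1 / β) * -β = 1 by field_simp, Real.rpow_one]
    field_simp
  -- The height is matched to the radius by scaling, so that `{f > h}` has volume at most `ρ ^ n`.
  set h : ℝ := ρ ^ (-(β + α - σ)) with hh
  have hh0 : 0 < h := by positivity
  set S := {y | ENNReal.ofReal h < f y} with hS
  have hSm : MeasurableSet S := measurableSet_lt measurable_const hf
  have hSv : volume S ≤ ENNReal.ofReal (ρ ^ (n : ℝ)) := by
    refine (hw h hh0).trans (ENNReal.ofReal_le_ofReal (le_of_eq ?_))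
    rw [hh, one_div, ← Real.rpow_neg hρ.le, ← Real.rpow_mul hρ.le]
    congr 1; field_simp
  have hSf : ∫⁻ y in S, wt σ y * f y ≤ ENNReal.ofReal (C₂ * A' * ρ ^ (n - (β + α))) := by
    refine (hb₂ hA' (by positivity) (by fun_prop) (hwA' f hw) hSv).trans
      (ENNReal.ofReal_le_ofReal (le_of_eq ?_))
    rw [← Real.rpow_mul hρ.le]
    congr 2; field_simp
  set N : EuclideanSpace ℝ (Fin n) → ℝ≥0∞ := fun x =>
    ∫⁻ y in S ∩ Metric.ball x ρ, wt (n - α) (x - y) * wt σ y * f y with hN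
  have hNi : ∫⁻ x, N x ≤ ENNReal.ofReal (M * ρ ^ (n - β)) := by
    refine (lintegral_near_le f hf (fun y => hb₃ y ρ hρ)).trans ?_
    refine (mul_le_mul_right hSf _).trans ?_
    rw [← ENNReal.ofReal_mul (by positivity)]
    refine ENNReal.ofReal_le_ofReal (le_of_eq ?_)
    rw [show (n : ℝ) - β = α + (n - (β + α)) by ring, Real.rpow_add hρ]
    ring
  have hpt : ∀ x, potential α σ f x ≤
      ENNReal.ofReal ((C₁ * A + C₂ * A') * ρ ^ (-β)) + N x := by
    intro x
    have e1 : ∫⁻ y in Sᶜ, wt (n - α) (x - y) * wt σ y * f y ≤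
        ENNReal.ofReal (C₁ * A * ρ ^ (-β)) := by
      have hSc : Sᶜ = {y | f y ≤ ENNReal.ofReal h} := by ext y; simp [hS]
      rw [hSc]
      refine (hb₁ (k := fun y => wt (n - α) (x - y) * wt σ y) hA hh0 hf (by fun_prop) hw
        (hwA x)).trans (ENNReal.ofReal_le_ofReal (le_of_eq ?_))
      rw [hh, ← Real.rpow_mul hρ.le]
      congr 2
      field_simp
      ring
    have e2 : ∫⁻ y in S \ Metric.ball x ρ, wt (n - α) (x - y) * wt σ y * f y ≤
        ENNReal.ofReal (C₂ * A' * ρ ^ (-β)) := by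
      calc _ ≤ ∫⁻ y in S \ Metric.ball x ρ, ENNReal.ofReal (ρ ^ (-(n - α))) * (wt σ y * f y) := by
            refine setLIntegral_mono' (hSm.diff measurableSet_ball) fun y hy => ?_
            rw [mul_assoc]
            gcongr
            refine ENNReal.ofReal_le_ofReal ?_
            have : ρ ≤ ‖x - y‖ := by
              have := hy.2
              rwa [Metric.mem_ball, not_lt, dist_comm, dist_eq_norm] at this
            rw [Real.rpow_neg hρ.le]
            exact inv_anti₀ (by positivity) (Real.rpow_le_rpow hρ.le this hnα.le)
        _ ≤ ∫⁻ y in S, ENNReal.ofReal (ρ ^ (-(n - α))) * (wt σ y * f y) :=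
            lintegral_mono_set Set.sdiff_subset
        _ ≤ _ := by
            rw [lintegral_const_mul _ (by fun_prop)]
            refine (mul_le_mul_right hSf _).trans ?_
            rw [← ENNReal.ofReal_mul (by positivity)]
            refine ENNReal.ofReal_le_ofReal (le_of_eq ?_)
            rw [show -β = -(n - α) + (n - (β + α)) by ring, Real.rpow_add hρ]
            ring
    rw [add_mul, ENNReal.ofReal_add (by positivity) (by positivity)]
    calc potential α σ f x = _ := (lintegral_add_compl _ hSm).symm
      _ = (N x + ∫⁻ y in S \ Metric.ball x ρ, wt (n - α) (x - y) * wt σ y * f y) +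
          ∫⁻ y in Sᶜ, wt (n - α) (x - y) * wt σ y * f y := by
          rw [hN, lintegral_inter_add_sdiff _ _ measurableSet_ball]
      _ ≤ (N x + ENNReal.ofReal (C₂ * A' * ρ ^ (-β))) + ENNReal.ofReal (C₁ * A * ρ ^ (-β)) := by
          gcongr
      _ = _ := by ring
  have hsub : {x | ENNReal.ofReal s < potential α σ f x} ⊆ {x | ENNReal.ofReal (ρ ^ (-β)) ≤ N x} := by
    intro x hx
    simp only [Set.mem_ofPred_eq] at hx ⊢
    have h1 := hx.trans_le (hpt x)
    rw [hsρ, hK, add_mul _ 1, one_mul, ENNReal.ofReal_add (by positivity) (by positivity)] at h1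
    exact ((ENNReal.add_lt_add_iff_left ENNReal.ofReal_ne_top).1 h1).le
  have hNm : Measurable N := by
    simp_rw [hN, setLIntegral_inter_ball_eq]
    refine Measurable.lintegral_prod_right' (f := {p : EuclideanSpace ℝ (Fin n) × EuclideanSpace ℝ (Fin n) |
        dist p.2 p.1 < ρ}.indicator (fun p => wt (n - α) (p.1 - p.2) * wt σ p.2 * f p.2)) ?_
    exact Measurable.indicator (by fun_prop) (measurableSet_lt (by fun_prop) measurable_const)
  refine (measure_mono hsub).trans ?_
  have hch := (mul_meas_ge_le_lintegral hNm (ENNReal.ofReal (ρ ^ (-β)))).trans hNi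
  have e : (K * M ^ (β / n) / s) ^ (n / β) = M * ρ ^ (n - β) / ρ ^ (-β) := by
    rw [hsρ, show K * M ^ (β / n) / (K * ρ ^ (-β)) = M ^ (β / n) * ρ ^ β by
      rw [Real.rpow_neg hρ.le]; field_simp, Real.mul_rpow (by positivity) (by positivity),
      ← Real.rpow_mul hM0.le, ← Real.rpow_mul hρ.le, show β / n * (n / β) = 1 by field_simp,
      show β * (n / β) = (n - β) - (-β) by field_simp; ring, Real.rpow_one, Real.rpow_sub hρ]
    ring
  rw [e, ENNReal.ofReal_div_of_pos (by positivity), ENNReal.le_div_iff_mul_le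
    (Or.inl (by positivity)) (Or.inl ENNReal.ofReal_ne_top), mul_comm]
  exact hch

/-- The weighted Riesz potential is bounded between weak Lebesgue spaces. -/
theorem exists_weakBound_potential [NeZero n] {α σ β : ℝ} (hα : 0 < α) (hαn : α < n)
    (hσ : 0 ≤ σ) (hσα : σ < α) (hβ : 0 < β) (hβα : β + α < n) :
    ∃ C : ℝ, 0 < C ∧ ∀ (A : ℝ) (f : EuclideanSpace ℝ (Fin n) → ℝ≥0∞), 0 < A → Measurable f →
      WeakBound (n / (β + α - σ)) A f → WeakBound (n / β) (C * A) (potential α σ f) := by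
  obtain ⟨C, hC, h⟩ := exists_weakBound_potential_of_one hα hαn hσ hσα hβ hβα
  refine ⟨C, hC, fun A f hA hf hw => ?_⟩
  have h1 := h (fun x => ENNReal.ofReal A⁻¹ * f x) (by fun_prop) (by
    simpa [inv_mul_cancel₀ hA.ne'] using hw.const_mul (inv_pos.2 hA))
  have h2 := h1.const_mul hA
  rw [mul_comm A C] at h2
  refine h2.mono fun x => le_of_eq ?_
  unfold potential
  rw [← lintegral_const_mul _ (by fun_prop)]
  refine lintegral_congr fun y => ?_
  rw [mul_left_comm, ← mul_assoc (ENNReal.ofReal A), ← ENNReal.ofReal_mul hA.le,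
    mul_inv_cancel₀ hA.ne']
  simp

end Potential

/-! ### Reflections in hyperplanes and comparison of potentials. -/

/-- The reflection of `x` in the hyperplane `⟪x, e⟫ = l`, for a unit vector `e`. -/
noncomputable def planeRefl {n : ℕ} (e : EuclideanSpace ℝ (Fin n)) (l : ℝ)
    (x : EuclideanSpace ℝ (Fin n)) : EuclideanSpace ℝ (Fin n) :=
  x - (2 * (inner ℝ x e - l)) • e

/-- The open half-space `⟪x, e⟫ > l`. -/
def halfSpace {n : ℕ} (e : EuclideanSpace ℝ (Fin n)) (l : ℝ) : Set (EuclideanSpace ℝ (Fin n)) :=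
  {x | l < inner ℝ x e}

section Reflection

variable {n : ℕ} {e : EuclideanSpace ℝ (Fin n)} {l : ℝ}

theorem mem_halfSpace {x : EuclideanSpace ℝ (Fin n)} : x ∈ halfSpace e l ↔ l < inner ℝ x e :=
  Iff.rfl

theorem isOpen_halfSpace : IsOpen (halfSpace e l) :=
  isOpen_lt continuous_const (by fun_prop)

theorem measurableSet_halfSpace : MeasurableSet (halfSpace e l) :=
  isOpen_halfSpace.measurableSet

theorem inner_planeRefl (he : ‖e‖ = 1) (x : EuclideanSpace ℝ (Fin n)) :
    inner ℝ (planeRefl e l x) e = 2 * l - inner ℝ x e := by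
  rw [planeRefl, inner_sub_left, real_inner_smul_left, real_inner_self_eq_norm_sq, he]
  ring

theorem planeRefl_planeRefl (he : ‖e‖ = 1) (x : EuclideanSpace ℝ (Fin n)) :
    planeRefl e l (planeRefl e l x) = x := by
  conv_lhs => rw [planeRefl, inner_planeRefl he, planeRefl]
  module

theorem planeRefl_of_inner_eq {x : EuclideanSpace ℝ (Fin n)} (hx : inner ℝ x e = l) :
    planeRefl e l x = x := by
  simp [planeRefl, hx]

theorem planeRefl_neg (x : EuclideanSpace ℝ (Fin n)) :
    planeRefl (-e) (-l) x = planeRefl e l x := by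
  rw [planeRefl, planeRefl, inner_neg_right]; module

theorem planeRefl_mem_halfSpace_neg (he : ‖e‖ = 1) {x : EuclideanSpace ℝ (Fin n)} :
    planeRefl e l x ∈ halfSpace (-e) (-l) ↔ x ∈ halfSpace e l := by
  rw [mem_halfSpace, mem_halfSpace, inner_neg_right, inner_planeRefl he]
  constructor <;> intro h <;> linarith

/-- The source of all the distance comparisons: the correction is a product of signed distances to
the hyperplane, positive for two points on the same side. -/
theorem norm_sub_planeRefl_sq (he : ‖e‖ = 1) (x y : EuclideanSpace ℝ (Fin n)) :
    ‖x - planeRefl e l y‖ ^ 2 = ‖x - y‖ ^ 2 + 4 * (inner ℝ x e - l) * (inner ℝ y e - l) := by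
  rw [show x - planeRefl e l y = (x - y) + (2 * (inner ℝ y e - l)) • e by
    rw [planeRefl]; module, norm_add_sq_real, norm_smul, he, real_inner_smul_right,
    inner_sub_left, mul_one, Real.norm_eq_abs, sq_abs]
  ring

theorem norm_planeRefl_sq (he : ‖e‖ = 1) (x : EuclideanSpace ℝ (Fin n)) :
    ‖planeRefl e l x‖ ^ 2 = ‖x‖ ^ 2 - 4 * l * (inner ℝ x e - l) := by
  have := norm_sub_planeRefl_sq (l := l) he 0 x
  simp only [zero_sub, norm_neg, inner_zero_left] at this
  rw [this]; ring

theorem norm_planeRefl_sub_planeRefl (he : ‖e‖ = 1) (x y : EuclideanSpace ℝ (Fin n)) :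
    ‖planeRefl e l x - planeRefl e l y‖ = ‖x - y‖ := by
  have h1 := norm_sub_planeRefl_sq (l := l) he (planeRefl e l x) y
  have h2 := norm_sub_planeRefl_sq (l := l) he y x
  rw [norm_sub_rev y, norm_sub_rev y] at h2
  rw [h2, inner_planeRefl he] at h1
  refine (sq_eq_sq₀ (norm_nonneg _) (norm_nonneg _)).1 ?_
  rw [h1]; ring

theorem norm_planeRefl_sub (he : ‖e‖ = 1) (x y : EuclideanSpace ℝ (Fin n)) :
    ‖planeRefl e l x - y‖ = ‖x - planeRefl e l y‖ := by
  conv_lhs => rw [← planeRefl_planeRefl (l := l) he y]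
  exact norm_planeRefl_sub_planeRefl he _ _

theorem norm_sub_lt_norm_sub_planeRefl (he : ‖e‖ = 1) {x y : EuclideanSpace ℝ (Fin n)}
    (hx : x ∈ halfSpace e l) (hy : y ∈ halfSpace e l) : ‖x - y‖ < ‖x - planeRefl e l y‖ := by
  refine (sq_lt_sq₀ (norm_nonneg _) (norm_nonneg _)).1 ?_
  rw [norm_sub_planeRefl_sq he]
  rw [mem_halfSpace] at hx hy
  have := mul_pos (sub_pos.2 hx) (sub_pos.2 hy)
  linarith

theorem norm_planeRefl_le (he : ‖e‖ = 1) (hl : 0 ≤ l) {x : EuclideanSpace ℝ (Fin n)}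
    (hx : x ∈ halfSpace e l) : ‖planeRefl e l x‖ ≤ ‖x‖ := by
  refine (sq_le_sq₀ (norm_nonneg _) (norm_nonneg _)).1 ?_
  rw [norm_planeRefl_sq he]
  have := mul_nonneg hl (sub_pos.2 (mem_halfSpace.1 hx)).le
  linarith

theorem norm_planeRefl_lt (he : ‖e‖ = 1) (hl : 0 < l) {x : EuclideanSpace ℝ (Fin n)}
    (hx : x ∈ halfSpace e l) : ‖planeRefl e l x‖ < ‖x‖ := by
  refine (sq_lt_sq₀ (norm_nonneg _) (norm_nonneg _)).1 ?_
  rw [norm_planeRefl_sq he]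
  have := mul_pos hl (sub_pos.2 (mem_halfSpace.1 hx))
  linarith

@[fun_prop]
theorem continuous_planeRefl : Continuous (planeRefl e l) := by
  unfold planeRefl; fun_prop

@[fun_prop]
theorem measurable_planeRefl : Measurable (planeRefl e l) := continuous_planeRefl.measurable

theorem measurePreserving_planeRefl (he : ‖e‖ = 1) :
    MeasurePreserving (planeRefl e l) (volume : Measure (EuclideanSpace ℝ (Fin n))) volume := by
  let L : EuclideanSpace ℝ (Fin n) →ₗ[ℝ] EuclideanSpace ℝ (Fin n) :=
    LinearMap.id - (2 : ℝ) • ((innerₗ _ e).smulRight e)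
  have hL : ∀ x, L x = planeRefl e 0 x := by
    intro x
    simp only [L, planeRefl, LinearMap.sub_apply, LinearMap.id_apply, LinearMap.smul_apply,
      LinearMap.smulRight_apply, innerₗ_apply_apply, smul_smul, sub_zero, real_inner_comm]
  have hinv : ∀ x, L (L x) = x := fun x => by rw [hL, hL, planeRefl_planeRefl he]
  let M : EuclideanSpace ℝ (Fin n) ≃ₗᵢ[ℝ] EuclideanSpace ℝ (Fin n) :=
    { LinearEquiv.ofInvolutive L hinv with
      norm_map' := fun x => by
        change ‖L x‖ = ‖x‖
        have := norm_planeRefl_sub_planeRefl (l := 0) he x 0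
        rw [sub_zero, ← hL, ← hL, map_zero, sub_zero] at this
        exact this }
  have h1 : planeRefl e l = (fun x => x + (2 * l) • e) ∘ M := by
    ext1 x
    change planeRefl e l x = L x + (2 * l) • e
    rw [hL, planeRefl, planeRefl]; module
  rw [h1]
  exact (measurePreserving_add_right volume _).comp M.measurePreserving

theorem volume_hyperplane (he : ‖e‖ = 1) :
    volume {x : EuclideanSpace ℝ (Fin n) | inner ℝ x e = l} = 0 := by
  have h0 : volume ((LinearMap.ker (innerₗ (EuclideanSpace ℝ (Fin n)) e) :
      Submodule ℝ (EuclideanSpace ℝ (Fin n))) : Set (EuclideanSpace ℝ (Fin n))) = 0 := by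
    refine Measure.addHaar_submodule _ _ fun h => ?_
    have : e ∈ LinearMap.ker (innerₗ (EuclideanSpace ℝ (Fin n)) e) := by rw [h]; trivial
    rw [LinearMap.mem_ker, innerₗ_apply_apply, real_inner_self_eq_norm_sq, he] at this
    norm_num at this
  rw [← measure_preimage_add_right volume (-(l • e))] at h0
  refine measure_mono_null (fun x hx => ?_) h0
  simp only [Set.mem_ofPred_eq] at hx
  rw [real_inner_comm] at hx
  simp only [Set.mem_preimage, SetLike.mem_coe, LinearMap.mem_ker, innerₗ_apply_apply,
    inner_add_right, inner_neg_right, real_inner_smul_right, real_inner_self_eq_norm_sq, he,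
    hx]
  ring

theorem lintegral_eq_halfSpace_add (he : ‖e‖ = 1) {g : EuclideanSpace ℝ (Fin n) → ℝ≥0∞}
    (hg : Measurable g) :
    ∫⁻ y, g y = ∫⁻ y in halfSpace e l, (g y + g (planeRefl e l y)) := by
  rw [lintegral_add_left hg, ← lintegral_add_compl g (measurableSet_halfSpace (e := e) (l := l))]
  congr 1
  rw [← (measurePreserving_planeRefl (l := l) he).setLIntegral_comp_preimage
    measurableSet_halfSpace.compl hg]
  refine setLIntegral_congr ?_
  have hnull := volume_hyperplane (l := l) he
  have : ∀ᵐ x : EuclideanSpace ℝ (Fin n), inner ℝ x e ≠ l := by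
    rw [ae_iff]; simpa using hnull
  filter_upwards [this] with x hx
  refine propext ?_
  change ¬ (l < inner ℝ (planeRefl e l x) e) ↔ l < inner ℝ x e
  rw [inner_planeRefl he, not_lt]
  constructor
  · intro h; exact lt_of_le_of_ne (by linarith) hx.symm
  · intro h; linarith

theorem wt_planeRefl_sub (he : ‖e‖ = 1) (a : ℝ) (x y : EuclideanSpace ℝ (Fin n)) :
    wt a (planeRefl e l x - y) = wt a (x - planeRefl e l y) := by
  rw [wt, wt, norm_planeRefl_sub he]

theorem wt_planeRefl_sub_planeRefl (he : ‖e‖ = 1) (a : ℝ) (x y : EuclideanSpace ℝ (Fin n)) :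
    wt a (planeRefl e l x - planeRefl e l y) = wt a (x - y) := by
  rw [wt, wt, norm_planeRefl_sub_planeRefl he]

theorem wt_sub_planeRefl_lt (he : ‖e‖ = 1) {a : ℝ} (ha : 0 < a) {x y : EuclideanSpace ℝ (Fin n)}
    (hx : x ∈ halfSpace e l) (hy : y ∈ halfSpace e l) (hxy : y ≠ x) :
    wt a (x - planeRefl e l y) < wt a (x - y) := by
  have h0 : 0 < ‖x - y‖ := norm_pos_iff.2 (sub_ne_zero.2 hxy.symm)
  have h1 := norm_sub_lt_norm_sub_planeRefl he hx hy
  exact (ENNReal.ofReal_lt_ofReal_iff (by positivity)).2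
    (inv_strictAnti₀ (by positivity) (Real.rpow_lt_rpow h0.le h1 ha))

/-- The reflected point must not be the origin because, when `σ ≠ 0`, the inverse in `wt` vanishes
there instead of being infinite. This excludes a single `y`, hence a null set. -/
theorem wt_le_wt_planeRefl (he : ‖e‖ = 1) {σ : ℝ} (hσ : 0 ≤ σ) (hl : σ = 0 ∨ 0 ≤ l)
    {y : EuclideanSpace ℝ (Fin n)} (hy : y ∈ halfSpace e l) (h0 : planeRefl e l y ≠ 0) :
    wt σ y ≤ wt σ (planeRefl e l y) := by
  rcases hl with rfl | hl
  · rw [wt_zero, wt_zero]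
  · have : 0 < ‖planeRefl e l y‖ := norm_pos_iff.2 h0
    exact ENNReal.ofReal_le_ofReal (inv_anti₀ (by positivity)
      (Real.rpow_le_rpow this.le (norm_planeRefl_le he hl hy) hσ))

theorem wt_lt_wt_planeRefl (he : ‖e‖ = 1) {σ : ℝ} (hσ : 0 < σ) (hl : 0 < l)
    {y : EuclideanSpace ℝ (Fin n)} (hy : y ∈ halfSpace e l) (h0 : planeRefl e l y ≠ 0) :
    wt σ y < wt σ (planeRefl e l y) := by
  have : 0 < ‖planeRefl e l y‖ := norm_pos_iff.2 h0
  exact (ENNReal.ofReal_lt_ofReal_iff (by positivity)).2 (inv_strictAnti₀ (by positivity)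
    (Real.rpow_lt_rpow this.le (norm_planeRefl_lt he hl hy) hσ))

theorem ae_planeRefl_ne_zero [NeZero n] (he : ‖e‖ = 1) :
    ∀ᵐ y : EuclideanSpace ℝ (Fin n), planeRefl e l y ≠ 0 := by
  have : Nontrivial (EuclideanSpace ℝ (Fin n)) := ⟨e, 0, fun h => by simp [h] at he⟩
  refine measure_mono_null (t := {planeRefl e l 0}) (fun y hy => ?_) (measure_singleton _)
  simp only [Set.mem_compl_iff, Set.mem_ofPred_eq, not_not] at hy
  rw [Set.mem_singleton_iff, ← hy, planeRefl_planeRefl he]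

theorem ae_ne_of_unit (he : ‖e‖ = 1) (x : EuclideanSpace ℝ (Fin n)) :
    ∀ᵐ y : EuclideanSpace ℝ (Fin n), y ≠ x := by
  have : Nontrivial (EuclideanSpace ℝ (Fin n)) := ⟨e, 0, fun h => by simp [h] at he⟩
  exact measure_mono_null (t := {x}) (fun y hy => by simpa using hy) (measure_singleton _)

theorem potential_eq_halfSpace (he : ‖e‖ = 1) {α σ : ℝ} {F : EuclideanSpace ℝ (Fin n) → ℝ≥0∞}
    (hF : Measurable F) (x : EuclideanSpace ℝ (Fin n)) :
    potential α σ F x = ∫⁻ y in halfSpace e l, (wt (n - α) (x - y) * (wt σ y * F y) +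
      wt (n - α) (x - planeRefl e l y) * (wt σ (planeRefl e l y) * F (planeRefl e l y))) := by
  unfold potential
  simp only [mul_assoc]
  exact lintegral_eq_halfSpace_add he (by fun_prop)

theorem potential_planeRefl_eq_halfSpace (he : ‖e‖ = 1) {α σ : ℝ}
    {F : EuclideanSpace ℝ (Fin n) → ℝ≥0∞} (hF : Measurable F) (x : EuclideanSpace ℝ (Fin n)) :
    potential α σ F (planeRefl e l x) =
      ∫⁻ y in halfSpace e l, (wt (n - α) (x - planeRefl e l y) * (wt σ y * F y) +
      wt (n - α) (x - y) * (wt σ (planeRefl e l y) * F (planeRefl e l y))) := by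
  rw [potential_eq_halfSpace (l := l) he hF]
  simp only [wt_planeRefl_sub_planeRefl he, wt_planeRefl_sub he]

/-- Fold both potentials onto the half-space. Let `k + d` and `k` be the kernels to `y` and to its
reflection, and `f`, `f'` the weighted densities there. The integrands at `x` and at its reflection
are `(k + d) f + k f'` and `k f + (k + d) f'`. Only the term `d f` needs the hypothesis; the rest is
absorbed because `c ≥ 1`. The factor `c` serves the weighted convexity inequality used later. -/
theorem potential_le_add (he : ‖e‖ = 1) {α σ : ℝ} (hαn : α < n) (hσ : 0 ≤ σ)
    (hl : σ = 0 ∨ 0 ≤ l) {F G : EuclideanSpace ℝ (Fin n) → ℝ≥0∞} (hF : Measurable F)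
    (hG : Measurable G) {c : ℝ≥0∞} (hc : 1 ≤ c) (hc' : c ≠ ∞)
    (h : ∀ y ∈ halfSpace e l, F y ≤ c * F (planeRefl e l y) + G y)
    {x : EuclideanSpace ℝ (Fin n)} (hx : x ∈ halfSpace e l) :
    potential α σ F x ≤ c * potential α σ F (planeRefl e l x) +
      potential α σ ((halfSpace e l).indicator G) x := by
  have hna : (0 : ℝ) < n - α := by linarith
  have hn : NeZero n := ⟨fun h => by
    subst h; rw [Subsingleton.elim e 0] at he; simp at he⟩
  have h3 : potential α σ ((halfSpace e l).indicator G) x =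
      ∫⁻ y in halfSpace e l, wt (n - α) (x - y) * (wt σ y * G y) := by
    rw [← lintegral_indicator measurableSet_halfSpace]
    refine lintegral_congr fun y => ?_
    by_cases hy : y ∈ halfSpace e l <;> simp [hy, mul_assoc]
  rw [potential_planeRefl_eq_halfSpace he hF, potential_eq_halfSpace (l := l) he hF, h3,
    ← lintegral_const_mul' _ _ hc', ← lintegral_add_left (by fun_prop)]
  refine lintegral_mono_ae ?_
  filter_upwards [ae_restrict_of_ae (ae_planeRefl_ne_zero (l := l) he),
    ae_restrict_of_ae (ae_ne_of_unit he x), ae_restrict_mem measurableSet_halfSpace] with y h0 hyx hy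
  have hk := (wt_sub_planeRefl_lt he hna hx hy hyx).le
  have hw := wt_le_wt_planeRefl he hσ hl hy h0
  obtain ⟨d, hd⟩ := exists_add_of_le hk
  have hf : wt σ y * F y ≤
      c * (wt σ (planeRefl e l y) * F (planeRefl e l y)) + wt σ y * G y := by
    calc wt σ y * F y ≤ wt σ y * (c * F (planeRefl e l y) + G y) := by gcongr; exact h y hy
      _ = c * (wt σ y * F (planeRefl e l y)) + wt σ y * G y := by ring
      _ ≤ _ := by gcongr
  rw [hd]
  generalize wt σ y * F y = f at hf ⊢
  generalize wt σ (planeRefl e l y) * F (planeRefl e l y) = f' at hf ⊢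
  generalize wt σ y * G y = g at hf ⊢
  generalize wt (n - α) (x - planeRefl e l y) = k
  calc (k + d) * f + k * f' = 1 * (k * f) + d * f + 1 * (k * f') := by ring
    _ ≤ c * (k * f) + d * (c * f' + g) + c * (k * f') := by gcongr
    _ = c * (k * f + (k + d) * f') + d * g := by ring
    _ ≤ _ := by gcongr; exact le_add_self

/-- After folding, the integrands differ by `d * (f' - f)`, which is nonnegative with `d > 0` a.e.
Equal finite integrals therefore force `f = f'`. -/
theorem ae_eq_of_potential_eq (he : ‖e‖ = 1) {α σ : ℝ} (hαn : α < n) (hσ : 0 ≤ σ)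
    (hl : σ = 0 ∨ 0 ≤ l) {F : EuclideanSpace ℝ (Fin n) → ℝ≥0∞} (hF : Measurable F)
    (hFt : ∀ y, F y ≠ ∞)
    (h : ∀ y ∈ halfSpace e l, F y ≤ F (planeRefl e l y))
    {x : EuclideanSpace ℝ (Fin n)} (hx : x ∈ halfSpace e l) (hxt : potential α σ F x ≠ ∞)
    (heq : potential α σ F (planeRefl e l x) ≤ potential α σ F x) :
    ∀ᵐ y : EuclideanSpace ℝ (Fin n), y ∈ halfSpace e l →
      wt σ y * F y = wt σ (planeRefl e l y) * F (planeRefl e l y) := by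
  have hna : (0 : ℝ) < n - α := by linarith
  have hn : NeZero n := ⟨fun h => by
    subst h; rw [Subsingleton.elim e 0] at he; simp at he⟩
  rw [← ae_restrict_iff' measurableSet_halfSpace]
  rw [potential_eq_halfSpace (l := l) he hF] at hxt
  rw [potential_planeRefl_eq_halfSpace he hF, potential_eq_halfSpace (l := l) he hF] at heq
  have haux : ∀ᵐ y ∂(volume.restrict (halfSpace e l)), y ∈ halfSpace e l ∧ y ≠ x ∧
      planeRefl e l y ≠ 0 := by
    filter_upwards [ae_restrict_of_ae (ae_planeRefl_ne_zero (l := l) he),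
      ae_restrict_of_ae (ae_ne_of_unit he x), ae_restrict_mem measurableSet_halfSpace] with y h0 hyx hy
    exact ⟨hy, hyx, h0⟩
  have key := ae_eq_of_ae_le_of_lintegral_le ?_ hxt (by fun_prop) heq
  · filter_upwards [haux, key] with y ⟨hy, hyx, h0⟩ hk
    obtain ⟨d, hd⟩ := exists_add_of_le (wt_sub_planeRefl_lt he hna hx hy hyx).le
    have hd0 : d ≠ 0 := by
      rintro rfl
      exact absurd hd (by rw [add_zero]; exact (wt_sub_planeRefl_lt he hna hx hy hyx).ne')
    have hdt : d ≠ ∞ := by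
      rintro rfl
      rw [add_top] at hd
      exact ENNReal.ofReal_ne_top hd
    have hkt : wt (n - α) (x - planeRefl e l y) ≠ ∞ := ENNReal.ofReal_ne_top
    have hft : wt σ y * F y ≠ ∞ := ENNReal.mul_ne_top ENNReal.ofReal_ne_top (hFt _)
    have hft' : wt σ (planeRefl e l y) * F (planeRefl e l y) ≠ ∞ :=
      ENNReal.mul_ne_top ENNReal.ofReal_ne_top (hFt _)
    rw [hd] at hk
    generalize wt σ y * F y = f at *
    generalize wt σ (planeRefl e l y) * F (planeRefl e l y) = f' at *
    generalize wt (n - α) (x - planeRefl e l y) = k at *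
    rw [show (k + d) * f + k * f' = (k * f + k * f') + d * f by ring,
      show k * f + (k + d) * f' = (k * f + k * f') + d * f' by ring,
      ENNReal.add_right_inj (ENNReal.add_ne_top.2 ⟨ENNReal.mul_ne_top hkt hft,
        ENNReal.mul_ne_top hkt hft'⟩), ENNReal.mul_right_inj hd0 hdt] at hk
    exact hk
  · filter_upwards [haux] with y ⟨hy, hyx, h0⟩
    obtain ⟨d, hd⟩ := exists_add_of_le (wt_sub_planeRefl_lt he hna hx hy hyx).le
    have hf : wt σ y * F y ≤ wt σ (planeRefl e l y) * F (planeRefl e l y) :=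
      mul_le_mul' (wt_le_wt_planeRefl he hσ hl hy h0) (h y hy)
    rw [hd]
    generalize wt σ y * F y = f at *
    generalize wt σ (planeRefl e l y) * F (planeRefl e l y) = f' at *
    generalize wt (n - α) (x - planeRefl e l y) = k at *
    calc (k + d) * f + k * f' = k * f + d * f + k * f' := by ring
      _ ≤ k * f + d * f' + k * f' := by gcongr
      _ = _ := by ring

end Reflection

/-! ### Elementary inequalities for real powers. -/

section RealInequalities

/-- Convexity of the power at `A / (1 - θ)` and `B / θ`, with weights `1 - θ` and `θ`. -/
theorem add_rpow_le_weighted {p A B θ : ℝ} (hp : 1 ≤ p) (hA : 0 ≤ A) (hB : 0 ≤ B) (hθ : 0 < θ)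
    (hθ1 : θ < 1) : (A + B) ^ p ≤ (1 - θ) ^ (1 - p) * A ^ p + θ ^ (1 - p) * B ^ p := by
  have h1 : 0 < 1 - θ := by linarith
  have h := (convexOn_rpow hp).2 (x := A / (1 - θ)) (y := B / θ)
    (Set.mem_Ici.2 (by positivity)) (Set.mem_Ici.2 (by positivity)) h1.le hθ.le (by ring)
  simp only [smul_eq_mul] at h
  rw [mul_div_cancel₀ _ h1.ne', mul_div_cancel₀ _ hθ.ne', Real.div_rpow hA h1.le,
    Real.div_rpow hB hθ.le] at h
  refine h.trans (le_of_eq ?_)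
  rw [Real.rpow_sub h1, Real.rpow_sub hθ, Real.rpow_one, Real.rpow_one]
  ring

/-- The choice `θ = W / (A + W)` makes the weighted inequality an equality when `Z = W ^ p`. Thus
the linear family in `θ` recovers the sharp Minkowski form. -/
theorem rpow_le_of_forall_weighted {p A W Z : ℝ} (hA : 0 < A) (hW : 0 < W)
    (h : ∀ θ : ℝ, 0 < θ → θ < 1 → (A + W) ^ p ≤ (1 - θ) ^ (1 - p) * A ^ p + θ ^ (1 - p) * Z) :
    W ^ p ≤ Z := by
  have hS : 0 < A + W := by positivity
  have h1 := h (W / (A + W)) (by positivity) (by rw [div_lt_one hS]; linarith)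
  rw [show 1 - W / (A + W) = A / (A + W) by field_simp; ring, Real.div_rpow hA.le hS.le,
    Real.div_rpow hW.le hS.le, Real.rpow_sub hA, Real.rpow_sub hW, Real.rpow_sub hS,
    Real.rpow_one, Real.rpow_one, Real.rpow_one] at h1
  have hAp : 0 < A ^ p := by positivity
  have hWp : 0 < W ^ p := by positivity
  have hSp : 0 < (A + W) ^ p := by positivity
  generalize A ^ p = a at *
  generalize W ^ p = w at *
  generalize (A + W) ^ p = s at *
  have e : A / a / ((A + W) / s) * a + W / w / ((A + W) / s) * Z =
      s * (A + W * (Z / w)) / (A + W) := by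
    field_simp
  rw [e, le_div_iff₀ hS, mul_le_mul_iff_right₀ hSp] at h1
  have h2 : W * 1 ≤ W * (Z / w) := by linarith
  have h3 := le_of_mul_le_mul_left h2 hW
  rwa [one_le_div hWp] at h3

/-- Bernoulli: the convex function lies above its tangent at `X`. -/
theorem rpow_sub_rpow_le {r X Y : ℝ} (hr : 1 ≤ r) (hY : 0 ≤ Y) (hX : 0 < X) :
    X ^ r ≤ Y ^ r + r * X ^ (r - 1) * (X - Y) := by
  have h := one_add_mul_self_le_rpow_one_add (s := Y / X - 1) (by
    have : 0 ≤ Y / X := by positivity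
    linarith) hr
  rw [show 1 + (Y / X - 1) = Y / X by ring, Real.div_rpow hY hX.le, le_div_iff₀ (by positivity)] at h
  have e : X ^ r = X ^ (r - 1) * X := by
    rw [← Real.rpow_add_one hX.ne']; ring_nf
  have e2 : (1 + r * (Y / X - 1)) * X ^ r = X ^ r + r * X ^ (r - 1) * (Y - X) := by
    rw [e]; field_simp
  rw [e2] at h
  linarith

end RealInequalities

/-! ### Semicontinuity of potentials and two limit arguments. -/

section PotentialBasic

variable {n : ℕ} {α σ : ℝ}

theorem potential_congr_ae {F G : EuclideanSpace ℝ (Fin n) → ℝ≥0∞} (h : F =ᵐ[volume] G)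
    (x : EuclideanSpace ℝ (Fin n)) : potential α σ F x = potential α σ G x :=
  lintegral_congr_ae (by filter_upwards [h] with y hy; rw [hy])

theorem potential_const_mul {c : ℝ≥0∞} (hc : c ≠ ∞) (F : EuclideanSpace ℝ (Fin n) → ℝ≥0∞)
    (x : EuclideanSpace ℝ (Fin n)) :
    potential α σ (fun y => c * F y) x = c * potential α σ F x := by
  unfold potential
  rw [← lintegral_const_mul' _ _ hc]
  exact lintegral_congr fun y => by ring

theorem potential_zero (x : EuclideanSpace ℝ (Fin n)) : potential α σ (fun _ => 0) x = 0 := by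
  simp [potential]

theorem continuousAt_wt {a : ℝ} {z : EuclideanSpace ℝ (Fin n)} (hz : z ≠ 0) :
    ContinuousAt (wt a) z := by
  have h : 0 < ‖z‖ := norm_pos_iff.2 hz
  refine ENNReal.continuous_ofReal.continuousAt.comp (ContinuousAt.inv₀ ?_ (by positivity))
  exact continuous_norm.continuousAt.rpow_const (Or.inl h.ne')

/-- Fatou, since the kernel is continuous off the diagonal. -/
theorem potential_le_liminf [NeZero n] {F : EuclideanSpace ℝ (Fin n) → ℝ≥0∞} (hF : AEMeasurable F)
    {xs : ℕ → EuclideanSpace ℝ (Fin n)} {x : EuclideanSpace ℝ (Fin n)}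
    (hx : Tendsto xs atTop (𝓝 x)) :
    potential α σ F x ≤ liminf (fun k => potential α σ F (xs k)) atTop := by
  have hne : ∀ᵐ y : EuclideanSpace ℝ (Fin n), y ≠ x :=
    measure_mono_null (t := {x}) (fun y hy => by simpa using hy) (measure_singleton _)
  refine le_trans ?_ (lintegral_liminf_le' fun k => ?_)
  · refine lintegral_mono_ae ?_
    filter_upwards [hne] with y hy
    refine le_of_eq (Tendsto.liminf_eq ?_).symm
    have hxy : x - y ≠ 0 := sub_ne_zero.2 hy.symm
    simp only [mul_assoc]
    refine ENNReal.Tendsto.mul_const ((continuousAt_wt hxy).tendsto.comp (hx.sub_const y)) (Or.inl ?_)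
    have : 0 < ‖x - y‖ := norm_pos_iff.2 hxy
    exact (ENNReal.ofReal_pos.2 (by positivity)).ne'
  · exact AEMeasurable.mul (Measurable.aemeasurable (by fun_prop)) hF

theorem lowerSemicontinuous_potential [NeZero n] {F : EuclideanSpace ℝ (Fin n) → ℝ≥0∞}
    (hF : AEMeasurable F) : LowerSemicontinuous (potential α σ F) := by
  rw [lowerSemicontinuous_iff_isClosed_preimage]
  intro c
  refine IsSeqClosed.isClosed fun xs x hxs hx => ?_
  exact (potential_le_liminf hF hx).trans (liminf_le_of_frequently_le'
    (Frequently.of_forall fun k => hxs k))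

theorem tendsto_setLIntegral_zero_of_ae {X : Type*} [MeasurableSpace X] {μ : Measure X}
    {g : X → ℝ≥0∞} (hg : Measurable g) (hgi : ∫⁻ x, g x ∂μ ≠ ∞) {D : ℕ → Set X}
    (hD : ∀ k, MeasurableSet (D k)) (h : ∀ᵐ x ∂μ, ∀ᶠ k in atTop, x ∉ D k) :
    Tendsto (fun k => ∫⁻ x in D k, g x ∂μ) atTop (𝓝 0) := by
  simp_rw [← lintegral_indicator (hD _)]
  rw [← lintegral_zero (μ := μ)]
  refine tendsto_lintegral_of_dominated_convergence g (fun k => hg.indicator (hD k))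
    (fun k => Eventually.of_forall fun x => Set.indicator_le_self _ _ _) hgi ?_
  filter_upwards [h] with x hx
  refine tendsto_const_nhds.congr' ?_
  filter_upwards [hx] with k hk
  rw [Set.indicator_of_notMem hk]

/-- Iterating the halving from one finite bound kills every level set. This is how a contraction
estimate in a weak space yields vanishing without defining a norm. -/
theorem WeakBound.ae_eq_zero {X : Type*} [MeasureSpace X] {t A : ℝ} {f : X → ℝ≥0∞} (ht : 0 < t)
    (hA : 0 < A) (hf : WeakBound t A f)
    (h : ∀ B : ℝ, 0 < B → WeakBound t B f → WeakBound t (B / 2) f) : f =ᵐ[volume] 0 := by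
  have h1 : ∀ k : ℕ, WeakBound t (A * (1 / 2) ^ k) f := by
    intro k
    induction k with
    | zero => simpa using hf
    | succ k ih =>
      have := h _ (by positivity) ih
      rwa [show A * (1 / 2) ^ k / 2 = A * (1 / 2) ^ (k + 1) by ring] at this
  have h2 : ∀ s : ℝ, 0 < s → volume {x | ENNReal.ofReal s < f x} = 0 := by
    intro s hs
    have hlim : Tendsto (fun k : ℕ => ENNReal.ofReal ((A * (1 / 2) ^ k / s) ^ t)) atTop (𝓝 0) := by
      rw [← ENNReal.ofReal_zero]
      refine ENNReal.tendsto_ofReal ?_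
      have : Tendsto (fun k : ℕ => A * (1 / 2 : ℝ) ^ k / s) atTop (𝓝 0) := by
        simpa using ((tendsto_pow_atTop_nhds_zero_of_lt_one (r := (1 / 2 : ℝ)) (by norm_num)
          (by norm_num)).const_mul A).div_const s
      simpa [Real.zero_rpow ht.ne'] using this.rpow_const (Or.inr ht.le)
    exact le_antisymm (ge_of_tendsto' hlim fun k => h1 k s hs) bot_le
  have h3 : ∀ᵐ x, ∀ m : ℕ, f x ≤ ENNReal.ofReal (1 / ((m : ℝ) + 1)) := by
    rw [ae_all_iff]
    intro m
    rw [ae_iff]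
    simpa only [not_le] using h2 (1 / ((m : ℝ) + 1)) (by positivity)
  filter_upwards [h3] with x hx
  have hl : Tendsto (fun m : ℕ => ENNReal.ofReal (1 / ((m : ℝ) + 1))) atTop (𝓝 0) := by
    rw [← ENNReal.ofReal_zero]
    exact ENNReal.tendsto_ofReal tendsto_one_div_add_atTop_nhds_zero_nat
  exact le_antisymm (ge_of_tendsto' hl hx) bot_le

end PotentialBasic

/-! ### The abstract system and the bound on its scaling exponents. -/

/-- A solution `(U, V)` of the integral system with values in `(0, ∞)`, integrable with the
exponents `n / a` and `n / b` given by the scaling of the system. -/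
structure SystemData (n : ℕ) (α p q σ₁ σ₂ a b : ℝ) (U V : EuclideanSpace ℝ (Fin n) → ℝ≥0∞) :
    Prop where
  α_pos : 0 < α
  α_lt : α < n
  p_pos : 0 < p
  q_pos : 0 < q
  one_lt : 1 < p * q
  σ₁_nonneg : 0 ≤ σ₁
  σ₁_lt : σ₁ < α
  σ₂_nonneg : 0 ≤ σ₂
  σ₂_lt : σ₂ < α
  a_pos : 0 < a
  b_pos : 0 < b
  rel_a : a + α - σ₁ = q * b
  rel_b : b + α - σ₂ = p * a
  measurable_U : Measurable U
  measurable_V : Measurable V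
  U_ne_zero : ∀ x, U x ≠ 0
  V_ne_zero : ∀ x, V x ≠ 0
  U_ne_top : ∀ x, U x ≠ ∞
  V_ne_top : ∀ x, V x ≠ ∞
  eq_U : ∀ x, U x = potential α σ₁ (fun y => V y ^ q) x
  eq_V : ∀ x, V x = potential α σ₂ (fun y => U y ^ p) x
  int_U : ∫⁻ x, U x ^ (n / a) ≠ ∞
  int_V : ∫⁻ x, V x ^ (n / b) ≠ ∞

namespace SystemData

variable {n : ℕ} {α p q σ₁ σ₂ a b : ℝ} {U V : EuclideanSpace ℝ (Fin n) → ℝ≥0∞}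

theorem swap (d : SystemData n α p q σ₁ σ₂ a b U V) : SystemData n α q p σ₂ σ₁ b a V U where
  α_pos := d.α_pos
  α_lt := d.α_lt
  p_pos := d.q_pos
  q_pos := d.p_pos
  one_lt := by rw [mul_comm]; exact d.one_lt
  σ₁_nonneg := d.σ₂_nonneg
  σ₁_lt := d.σ₂_lt
  σ₂_nonneg := d.σ₁_nonneg
  σ₂_lt := d.σ₁_lt
  a_pos := d.b_pos
  b_pos := d.a_pos
  rel_a := d.rel_b
  rel_b := d.rel_a
  measurable_U := d.measurable_V
  measurable_V := d.measurable_U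
  U_ne_zero := d.V_ne_zero
  V_ne_zero := d.U_ne_zero
  U_ne_top := d.V_ne_top
  V_ne_top := d.U_ne_top
  eq_U := d.eq_V
  eq_V := d.eq_U
  int_U := d.int_V
  int_V := d.int_U

theorem n_pos (d : SystemData n α p q σ₁ σ₂ a b U V) : (0 : ℝ) < n := d.α_pos.trans d.α_lt

theorem neZero (d : SystemData n α p q σ₁ σ₂ a b U V) : NeZero n :=
  ⟨fun h => by have := d.n_pos; rw [h] at this; simp at this⟩

theorem lowerSemicontinuous_U (d : SystemData n α p q σ₁ σ₂ a b U V) :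
    LowerSemicontinuous U := by
  have := d.neZero
  have h : U = potential α σ₁ (fun y => V y ^ q) := funext d.eq_U
  rw [h]
  exact lowerSemicontinuous_potential (d.measurable_V.pow_const q).aemeasurable

/-- Keep only the mass in the unit ball, where `‖x - y‖ ≤ 1 + ‖x‖`. -/
theorem exists_lower_bound (d : SystemData n α p q σ₁ σ₂ a b U V) :
    ∃ c : ℝ, 0 < c ∧ ∀ x, ENNReal.ofReal (c * (1 + ‖x‖) ^ (-(n - α))) ≤ U x := by
  have := d.neZero
  have hna : (0 : ℝ) < n - α := by linarith [d.α_lt]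
  set I := ∫⁻ y in Metric.ball (0 : EuclideanSpace ℝ (Fin n)) 1, wt σ₁ y * V y ^ q with hI
  have hVm := d.measurable_V
  have hI0 : I ≠ 0 := by
    intro h0
    rw [hI, setLIntegral_eq_zero_iff measurableSet_ball (by fun_prop)] at h0
    have hne : ∀ᵐ y : EuclideanSpace ℝ (Fin n), y ≠ 0 :=
      measure_mono_null (t := {0}) (fun y hy => by simpa using hy) (measure_singleton _)
    have : volume (Metric.ball (0 : EuclideanSpace ℝ (Fin n)) 1) = 0 := by
      refine measure_mono_null (t := {y | ¬ (y ∉ Metric.ball (0 : EuclideanSpace ℝ (Fin n)) 1)})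
        (fun y hy => by simpa using hy) ?_
      rw [← ae_iff]
      filter_upwards [h0, hne] with y hy hy0 hyb
      have := hy hyb
      rw [mul_eq_zero] at this
      rcases this with h | h
      · have h2 : 0 < ‖y‖ := norm_pos_iff.2 hy0
        rw [wt, ENNReal.ofReal_eq_zero] at h
        exact absurd h (not_le.2 (by positivity))
      · rw [ENNReal.rpow_eq_zero_iff_of_pos d.q_pos] at h
        exact d.V_ne_zero _ h
    exact (Metric.measure_ball_pos volume _ one_pos).ne' this
  obtain ⟨c, hc, hcI⟩ : ∃ c : ℝ, 0 < c ∧ ENNReal.ofReal c ≤ I := by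
    by_cases ht : I = ∞
    · exact ⟨1, one_pos, by simp [ht]⟩
    · exact ⟨I.toReal, ENNReal.toReal_pos hI0 ht, by rw [ENNReal.ofReal_toReal ht]⟩
  refine ⟨c, hc, fun x => ?_⟩
  have hne : ∀ᵐ y : EuclideanSpace ℝ (Fin n), y ≠ x :=
      measure_mono_null (t := {x}) (fun y hy => by simpa using hy) (measure_singleton _)
  rw [d.eq_U, mul_comm, ENNReal.ofReal_mul (by positivity)]
  calc _ ≤ ENNReal.ofReal ((1 + ‖x‖) ^ (-(n - α))) * I := by gcongr
    _ = ∫⁻ y in Metric.ball (0 : EuclideanSpace ℝ (Fin n)) 1,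
          ENNReal.ofReal ((1 + ‖x‖) ^ (-(n - α))) * (wt σ₁ y * V y ^ q) := by
        rw [lintegral_const_mul _ (by fun_prop)]
    _ ≤ ∫⁻ y in Metric.ball (0 : EuclideanSpace ℝ (Fin n)) 1,
          wt (n - α) (x - y) * wt σ₁ y * V y ^ q := by
        refine lintegral_mono_ae ?_
        filter_upwards [ae_restrict_of_ae hne, ae_restrict_mem measurableSet_ball] with y hy hyb
        rw [mul_assoc (wt _ _)]
        gcongr
        have h1 : 0 < ‖x - y‖ := norm_pos_iff.2 (sub_ne_zero.2 hy.symm)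
        refine ENNReal.ofReal_le_ofReal ?_
        rw [Real.rpow_neg (by positivity)]
        refine inv_anti₀ (by positivity) (Real.rpow_le_rpow h1.le ?_ hna.le)
        rw [mem_ball_zero_iff] at hyb
        linarith [norm_sub_le x y]
    _ ≤ _ := setLIntegral_le_lintegral _ _

/-- If `a ≥ n - α`, the lower bound on `U` decays too slowly for `U ^ (n / a)` to be integrable. -/
theorem a_add_lt (d : SystemData n α p q σ₁ σ₂ a b U V) : a + α < n := by
  have := d.neZero
  have hn := d.n_pos
  have ha := d.a_pos
  by_contra hcon
  push Not at hcon
  obtain ⟨c, hc, hcU⟩ := d.exists_lower_bound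
  obtain ⟨ω, hω, hb⟩ := exists_volume_ball_le (n := n)
  obtain ⟨e, he⟩ : ∃ e : EuclideanSpace ℝ (Fin n), ‖e‖ = 1 := by
    refine ⟨EuclideanSpace.single 0 1, by simp⟩
  -- These balls escape to infinity, yet their radii are comparable to the distance from the origin.
  -- Under the assumed inequality each carries at least a fixed amount of the integral of `U ^ (n /
  -- a)`.
  set D : ℕ → Set (EuclideanSpace ℝ (Fin n)) := fun k =>
    Metric.ball ((3 * ((k : ℝ) + 1)) • e) (k + 1) with hD
  have hDn : ∀ k x, x ∈ D k → ((k : ℝ) + 1) ≤ ‖x‖ ∧ 1 + ‖x‖ ≤ 5 * (k + 1) := by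
    intro k x hx
    rw [hD, Metric.mem_ball, dist_eq_norm] at hx
    have hk : (0 : ℝ) ≤ k := by positivity
    have h1 : ‖(3 * ((k : ℝ) + 1)) • e‖ = 3 * (k + 1) := by
      rw [norm_smul, he, Real.norm_of_nonneg (by positivity), mul_one]
    have h2 := norm_sub_norm_le ((3 * ((k : ℝ) + 1)) • e) x
    have h3 := norm_sub_norm_le x ((3 * ((k : ℝ) + 1)) • e)
    rw [norm_sub_rev] at h2
    constructor <;> linarith
  have hlim := tendsto_setLIntegral_zero_of_ae (d.measurable_U.pow_const (n / a)) d.int_U (D := D)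
    (fun k => measurableSet_ball) (Eventually.of_forall fun x => by
      obtain ⟨N, hN⟩ := exists_nat_gt ‖x‖
      filter_upwards [eventually_ge_atTop N] with k hk hx
      have : (N : ℝ) ≤ k := by exact_mod_cast hk
      linarith [(hDn k x hx).1])
  have hlow : ∀ k, ENNReal.ofReal (c ^ (n / a) * ω * 5 ^ (-(n : ℝ))) ≤
      ∫⁻ x in D k, U x ^ (n / a) := by
    intro k
    have hk : (0 : ℝ) ≤ k := by positivity
    calc _ = ENNReal.ofReal (c ^ (n / a) * (5 * ((k : ℝ) + 1)) ^ (-(n : ℝ))) * volume (D k) := by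
          rw [hD, hb _ _ (by positivity), ← ENNReal.ofReal_mul (by positivity)]
          congr 1
          rw [Real.mul_rpow (by norm_num) (by positivity), Real.rpow_neg (x := (k : ℝ) + 1)
            (by positivity)]
          have : (0 : ℝ) < ((k : ℝ) + 1) ^ (n : ℝ) := by positivity
          field_simp
      _ = ∫⁻ x in D k, ENNReal.ofReal (c ^ (n / a) * (5 * ((k : ℝ) + 1)) ^ (-(n : ℝ))) := by
          rw [setLIntegral_const]
      _ ≤ _ := by
          refine setLIntegral_mono' measurableSet_ball fun x hx => ?_
          refine le_trans ?_ (ENNReal.rpow_le_rpow (hcU x) (by positivity))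
          rw [ENNReal.ofReal_rpow_of_pos (by positivity)]
          refine ENNReal.ofReal_le_ofReal ?_
          rw [Real.mul_rpow hc.le (by positivity), ← Real.rpow_mul (by positivity)]
          gcongr
          calc (5 * ((k : ℝ) + 1)) ^ (-(n : ℝ)) ≤ (1 + ‖x‖) ^ (-(n : ℝ)) :=
                Real.rpow_le_rpow_of_nonpos (by positivity) (hDn k x hx).2 (by linarith)
            _ ≤ _ := by
                refine Real.rpow_le_rpow_of_exponent_le (by linarith [norm_nonneg x]) ?_
                rw [neg_mul, neg_le_neg_iff, mul_div_assoc', div_le_iff₀ ha]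
                nlinarith
  have := ge_of_tendsto' hlim hlow
  rw [nonpos_iff_eq_zero, ENNReal.ofReal_eq_zero] at this
  exact absurd this (not_le.2 (by positivity))

end SystemData

/-! ### The contraction estimate behind the moving planes. -/

namespace SystemData

variable {n : ℕ} {α p q σ₁ σ₂ a b : ℝ} {U V : EuclideanSpace ℝ (Fin n) → ℝ≥0∞}
  {e : EuclideanSpace ℝ (Fin n)} {l : ℝ}

/-- This is Minkowski's inequality in disguise, with truncated subtraction as positive part.
Expanding `U ^ p` by weighted convexity gives a comparison of `V` with its reflection for every `θ`,
and optimising over `θ` gives the claim. Here `p ≥ 1` also ensures `(1 - θ) ^ (1 - p) ≥ 1`, as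
`potential_le_add` requires. -/
theorem rpow_diff_le (d : SystemData n α p q σ₁ σ₂ a b U V) (hp : 1 ≤ p) (he : ‖e‖ = 1)
    (hl : σ₂ = 0 ∨ 0 ≤ l) {x : EuclideanSpace ℝ (Fin n)} (hx : x ∈ halfSpace e l) :
    (V x ^ (1 / p) - V (planeRefl e l x) ^ (1 / p)) ^ p ≤
      potential α σ₂ (fun y => (halfSpace e l).indicator
        (fun y => U y - U (planeRefl e l y)) y ^ p) x := by
  have hp0 := d.p_pos
  have hUm := d.measurable_U
  have hind : (fun y => (halfSpace e l).indicator (fun y => U y - U (planeRefl e l y)) y ^ p) =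
      (halfSpace e l).indicator (fun y => (U y - U (planeRefl e l y)) ^ p) := by
    ext y
    by_cases hy : y ∈ halfSpace e l <;> simp [hy, hp0]
  rw [hind]
  set Z := potential α σ₂ ((halfSpace e l).indicator
    (fun y => (U y - U (planeRefl e l y)) ^ p)) x with hZ
  have key : ∀ θ : ℝ, 0 < θ → θ < 1 → V x ≤ ENNReal.ofReal ((1 - θ) ^ (1 - p)) *
      V (planeRefl e l x) + ENNReal.ofReal (θ ^ (1 - p)) * Z := by
    intro θ hθ hθ1
    have h1 : 0 < 1 - θ := by linarith
    have h := potential_le_add he d.α_lt d.σ₂_nonneg hl (F := fun y => U y ^ p)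
      (G := fun y => ENNReal.ofReal (θ ^ (1 - p)) * (U y - U (planeRefl e l y)) ^ p)
      (hUm.pow_const p) (by fun_prop) (c := ENNReal.ofReal ((1 - θ) ^ (1 - p)))
      (by
        rw [← ENNReal.ofReal_one]
        exact ENNReal.ofReal_le_ofReal
          (Real.one_le_rpow_of_pos_of_le_one_of_nonpos h1 (by linarith) (by linarith)))
      ENNReal.ofReal_ne_top (fun y _ => by
        have hfin := d.U_ne_top (planeRefl e l y)
        have hfin' : U y - U (planeRefl e l y) ≠ ∞ := ENNReal.sub_ne_top (d.U_ne_top y)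
        have hsum : U y ≤ U (planeRefl e l y) + (U y - U (planeRefl e l y)) := le_add_tsub
        refine (ENNReal.rpow_le_rpow hsum hp0.le).trans ?_
        clear hsum
        generalize U y - U (planeRefl e l y) = w at *
        rw [← ENNReal.ofReal_toReal hfin, ← ENNReal.ofReal_toReal hfin',
          ← ENNReal.ofReal_add ENNReal.toReal_nonneg ENNReal.toReal_nonneg,
          ENNReal.ofReal_rpow_of_nonneg (by positivity) hp0.le,
          ENNReal.ofReal_rpow_of_nonneg (by positivity) hp0.le,
          ENNReal.ofReal_rpow_of_nonneg (by positivity) hp0.le,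
          ← ENNReal.ofReal_mul (by positivity), ← ENNReal.ofReal_mul (by positivity),
          ← ENNReal.ofReal_add (by positivity) (by positivity)]
        exact ENNReal.ofReal_le_ofReal (add_rpow_le_weighted hp ENNReal.toReal_nonneg
          ENNReal.toReal_nonneg hθ hθ1)) hx
    rw [← d.eq_V, ← d.eq_V] at h
    refine h.trans (le_of_eq ?_)
    rw [hZ, ← potential_const_mul ENNReal.ofReal_ne_top]
    congr 2
    ext y
    by_cases hy : y ∈ halfSpace e l <;> simp [hy]
  by_cases hle : V x ≤ V (planeRefl e l x)
  · rw [tsub_eq_zero_of_le (ENNReal.rpow_le_rpow hle (by positivity)), ENNReal.zero_rpow_of_pos hp0]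
    exact bot_le
  push Not at hle
  by_cases hZt : Z = ∞
  · rw [hZt]; exact le_top
  obtain ⟨X, hX, hVX⟩ : ∃ X : ℝ, 0 < X ∧ V x = ENNReal.ofReal X :=
    ⟨(V x).toReal, ENNReal.toReal_pos (d.V_ne_zero _) (d.V_ne_top _),
      (ENNReal.ofReal_toReal (d.V_ne_top _)).symm⟩
  obtain ⟨Y, hY, hVY⟩ : ∃ Y : ℝ, 0 < Y ∧ V (planeRefl e l x) = ENNReal.ofReal Y :=
    ⟨(V (planeRefl e l x)).toReal, ENNReal.toReal_pos (d.V_ne_zero _) (d.V_ne_top _),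
      (ENNReal.ofReal_toReal (d.V_ne_top _)).symm⟩
  obtain ⟨z, hz, hZz⟩ : ∃ z : ℝ, 0 ≤ z ∧ Z = ENNReal.ofReal z :=
    ⟨Z.toReal, ENNReal.toReal_nonneg, (ENNReal.ofReal_toReal hZt).symm⟩
  rw [hVX, hVY, ENNReal.ofReal_lt_ofReal_iff hX] at hle
  rw [hVX, hVY, hZz] at key
  rw [hVX, hVY, hZz]
  have hW : 0 < X ^ (1 / p) - Y ^ (1 / p) :=
    sub_pos.2 (Real.rpow_lt_rpow hY.le hle (by positivity))
  rw [ENNReal.ofReal_rpow_of_pos hX, ENNReal.ofReal_rpow_of_pos hY,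
    ← ENNReal.ofReal_sub _ (by positivity), ENNReal.ofReal_rpow_of_pos hW]
  refine ENNReal.ofReal_le_ofReal (rpow_le_of_forall_weighted (A := Y ^ (1 / p)) (by positivity)
    hW fun θ hθ hθ1 => ?_)
  have h1 : 0 < 1 - θ := by linarith
  have := key θ hθ hθ1
  rw [← ENNReal.ofReal_mul (by positivity), ← ENNReal.ofReal_mul (by positivity),
    ← ENNReal.ofReal_add (by positivity) (by positivity),
    ENNReal.ofReal_le_ofReal_iff (by positivity)] at this
  rw [add_sub_cancel, ← Real.rpow_mul hX.le, ← Real.rpow_mul hY.le, one_div,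
    inv_mul_cancel₀ hp0.ne', Real.rpow_one, Real.rpow_one]
  exact this

/-- Bernoulli with exponent `p * q > 1`, applied to the `1 / p`-th powers of `V` and its reflection,
linearises the difference of `q`-th powers. The factor `V ^ (q - 1 / p)` is needed only where `V`
exceeds its reflection, and it will be the small factor. -/
theorem diff_le (d : SystemData n α p q σ₁ σ₂ a b U V) (he : ‖e‖ = 1)
    (hl : σ₁ = 0 ∨ 0 ≤ l) {x : EuclideanSpace ℝ (Fin n)} (hx : x ∈ halfSpace e l) :
    U x - U (planeRefl e l x) ≤
      potential α σ₁ (fun y => ENNReal.ofReal (p * q) *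
        ({y | y ∈ halfSpace e l ∧ V (planeRefl e l y) < V y}.indicator V y ^ (q - 1 / p) *
        (halfSpace e l).indicator
          (fun y => V y ^ (1 / p) - V (planeRefl e l y) ^ (1 / p)) y)) x := by
  have hp0 := d.p_pos
  have hq0 := d.q_pos
  have hpq := d.one_lt
  have hqp : 0 < q - 1 / p := by
    rw [sub_pos, div_lt_iff₀ hp0]; linarith
  have hVm := d.measurable_V
  have hDm : MeasurableSet {y | y ∈ halfSpace e l ∧ V (planeRefl e l y) < V y} :=
    measurableSet_halfSpace.inter (measurableSet_lt (by fun_prop) hVm)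
  have hDVm := hVm.indicator hDm
  have h := potential_le_add he d.α_lt d.σ₁_nonneg hl (F := fun y => V y ^ q)
      (G := fun y => ENNReal.ofReal (p * q) *
        ({y | y ∈ halfSpace e l ∧ V (planeRefl e l y) < V y}.indicator V y ^ (q - 1 / p) *
          (V y ^ (1 / p) - V (planeRefl e l y) ^ (1 / p))))
      (hVm.pow_const q) (by fun_prop) (c := 1) le_rfl ENNReal.one_ne_top (fun y hy => ?_) hx
  · rw [← d.eq_U, ← d.eq_U, one_mul] at h
    rw [tsub_le_iff_left]
    refine h.trans (le_of_eq ?_)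
    congr 2
    ext y
    by_cases hy : y ∈ halfSpace e l <;> simp [hy]
  · rw [one_mul]
    rcases le_or_gt (V y) (V (planeRefl e l y)) with hle | hlt
    · exact le_add_right (ENNReal.rpow_le_rpow hle hq0.le)
    rw [Set.indicator_of_mem (show y ∈ {y | y ∈ halfSpace e l ∧ V (planeRefl e l y) < V y} from
      ⟨hy, hlt⟩)]
    have hX : 0 < (V y).toReal := ENNReal.toReal_pos (d.V_ne_zero _) (d.V_ne_top _)
    have hY : 0 < (V (planeRefl e l y)).toReal :=
      ENNReal.toReal_pos (d.V_ne_zero _) (d.V_ne_top _)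
    rw [← ENNReal.ofReal_toReal (d.V_ne_top y), ← ENNReal.ofReal_toReal
      (d.V_ne_top (planeRefl e l y))] at hlt ⊢
    generalize (V y).toReal = X at *
    generalize (V (planeRefl e l y)).toReal = Y at *
    rw [ENNReal.ofReal_lt_ofReal_iff hX] at hlt
    have hW : 0 < X ^ (1 / p) - Y ^ (1 / p) :=
      sub_pos.2 (Real.rpow_lt_rpow hY.le hlt (by positivity))
    rw [ENNReal.ofReal_rpow_of_pos hX, ENNReal.ofReal_rpow_of_pos hX, ENNReal.ofReal_rpow_of_pos hX,
      ENNReal.ofReal_rpow_of_pos hY, ENNReal.ofReal_rpow_of_pos hY,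
      ← ENNReal.ofReal_sub _ (by positivity), ← ENNReal.ofReal_mul (by positivity),
      ← ENNReal.ofReal_mul (by positivity),
      ← ENNReal.ofReal_add (by positivity) (mul_nonneg (by positivity)
        (mul_nonneg (by positivity) hW.le))]
    refine ENNReal.ofReal_le_ofReal ?_
    have h := rpow_sub_rpow_le (r := p * q) (X := X ^ (1 / p)) (Y := Y ^ (1 / p)) hpq.le
      (by positivity) (by positivity)
    rw [← Real.rpow_mul hX.le, ← Real.rpow_mul hX.le, ← Real.rpow_mul hY.le,
      show 1 / p * (p * q) = q by field_simp,
      show 1 / p * (p * q - 1) = q - 1 / p by field_simp, mul_assoc] at h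
    exact h

theorem exists_small_of_one_le (d : SystemData n α p q σ₁ σ₂ a b U V) (hp : 1 ≤ p) :
    ∃ ε : ℝ, 0 < ε ∧ ∀ (e : EuclideanSpace ℝ (Fin n)) (l : ℝ), ‖e‖ = 1 →
      (σ₁ = 0 ∨ 0 ≤ l) → (σ₂ = 0 ∨ 0 ≤ l) →
      ∫⁻ x in {y | y ∈ halfSpace e l ∧ V (planeRefl e l y) < V y}, V x ^ (n / b) ≤
        ENNReal.ofReal ε →
      ∀ x ∈ halfSpace e l, U x ≤ U (planeRefl e l x) ∧ V x ≤ V (planeRefl e l x) := by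
  have := d.neZero
  have hn := d.n_pos
  have hp0 := d.p_pos
  have hq0 := d.q_pos
  have ha := d.a_pos
  have hb := d.b_pos
  have hpq := d.one_lt
  have hqp : 0 < q - 1 / p := by
    rw [sub_pos, div_lt_iff₀ hp0]; linarith
  have hUm := d.measurable_U
  have hVm := d.measurable_V
  obtain ⟨C₁, hC₁, hb₁⟩ := exists_weakBound_potential (n := n) d.α_pos d.α_lt d.σ₁_nonneg d.σ₁_lt
    ha d.a_add_lt
  obtain ⟨C₂, hC₂, hb₂⟩ := exists_weakBound_potential (n := n) d.α_pos d.α_lt d.σ₂_nonneg d.σ₂_lt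
    hb d.swap.a_add_lt
  rw [d.rel_a] at hb₁
  rw [d.rel_b] at hb₂
  set t : ℝ := n / (q * b) with ht
  have ht0 : 0 < t := by positivity
  set M : ℝ := C₁ * (p * q * (2 ^ (1 / t) * C₂ ^ (1 / p))) with hM
  have hM0 : 0 < M := by positivity
  -- Chosen so that the round trip from `gU` through `gV` back to `gU` has factor `M * δ ^ (q - 1 /
  -- p) = 1 / 2`.
  set δ : ℝ := (1 / (2 * M)) ^ (1 / (q - 1 / p)) with hδ
  have hδ0 : 0 < δ := by positivity
  have hδM : M * δ ^ (q - 1 / p) = 1 / 2 := by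
    rw [hδ, ← Real.rpow_mul (by positivity), one_div_mul_cancel hqp.ne', Real.rpow_one]
    field_simp
  refine ⟨δ ^ (n / b), by positivity, fun e l he hl₁ hl₂ hsmall => ?_⟩
  have hDm : MeasurableSet {y | y ∈ halfSpace e l ∧ V (planeRefl e l y) < V y} :=
    measurableSet_halfSpace.inter (measurableSet_lt (by fun_prop) hVm)
  have hHm : MeasurableSet (halfSpace e l) := measurableSet_halfSpace
  set gU := (halfSpace e l).indicator (fun y => U y - U (planeRefl e l y)) with hgU
  set gV := (halfSpace e l).indicator
    (fun y => V y ^ (1 / p) - V (planeRefl e l y) ^ (1 / p)) with hgV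
  set DV := {y | y ∈ halfSpace e l ∧ V (planeRefl e l y) < V y}.indicator V with hDV
  have hgUm : Measurable gU := Measurable.indicator (by fun_prop) hHm
  have hgVm : Measurable gV := Measurable.indicator (by fun_prop) hHm
  have hDVm : Measurable DV := hVm.indicator hDm
  have h1 : ∀ x, gV x ≤ potential α σ₂ (fun y => gU y ^ p) x ^ (1 / p) := by
    intro x
    by_cases hx : x ∈ halfSpace e l
    · rw [hgV, Set.indicator_of_mem hx, one_div, ENNReal.le_rpow_inv_iff hp0, ← one_div]
      exact d.rpow_diff_le hp he hl₂ hx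
    · rw [hgV, Set.indicator_of_notMem hx]; exact bot_le
  have h2 : ∀ x, gU x ≤ potential α σ₁ (fun y => ENNReal.ofReal (p * q) *
      (DV y ^ (q - 1 / p) * gV y)) x := by
    intro x
    by_cases hx : x ∈ halfSpace e l
    · rw [hgU, Set.indicator_of_mem hx]
      exact d.diff_le he hl₁ hx
    · rw [hgU, Set.indicator_of_notMem hx]; exact bot_le
  have hDVw : WeakBound (n / b) δ DV := by
    refine WeakBound.of_lintegral_rpow_le hDVm.aemeasurable (by positivity) hδ0 (le_trans
      (le_of_eq ?_) hsmall)
    rw [← lintegral_indicator hDm]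
    refine lintegral_congr fun x => ?_
    have : 0 < (n : ℝ) / b := by positivity
    simp only [hDV, Set.indicator]
    split_ifs
    · rfl
    · exact ENNReal.zero_rpow_of_pos this
  have hae : gU =ᵐ[volume] 0 := by
    -- The iteration starts from `gU ≤ U`; the added `1` only keeps the bound positive.
    set I := (∫⁻ x, U x ^ (n / a)).toReal + 1 with hI
    have hI0 : 0 < I := by positivity
    refine WeakBound.ae_eq_zero (t := n / a) (A := I ^ (a / n)) (by positivity) (by positivity)
      ?_ ?_
    · refine WeakBound.of_lintegral_rpow_le hgUm.aemeasurable (by positivity) (by positivity) ?_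
      rw [← Real.rpow_mul hI0.le, show a / n * (n / a) = 1 by field_simp, Real.rpow_one]
      calc ∫⁻ x, gU x ^ (n / a) ≤ ∫⁻ x, U x ^ (n / a) := by
            refine lintegral_mono fun x => ENNReal.rpow_le_rpow ?_ (by positivity)
            exact (Set.indicator_le_self _ _ _).trans tsub_le_self
        _ = ENNReal.ofReal (∫⁻ x, U x ^ (n / a)).toReal := (ENNReal.ofReal_toReal d.int_U).symm
        _ ≤ _ := ENNReal.ofReal_le_ofReal (by linarith)
    -- Weak exponents: `gU ^ p` has `n / (p * a)`, its potential `n / b`, and `gV` has `p * n / b`.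
    -- Multiplication by `DV ^ (q - 1 / p)` gives `n / (q * b)`, and the second potential returns to
    -- `n / a`.
    · intro B hB hw
      have w1 := hw.rpow hB hp0
      rw [show (n : ℝ) / a / p = n / (p * a) by field_simp] at w1
      have w2 := (hb₂ _ _ (by positivity) (by fun_prop) w1).rpow (by positivity)
        (one_div_pos.2 hp0)
      have w3 := w2.mono h1
      have w4 := WeakBound.mul (t := t) (by positivity) (by positivity) (by positivity)
        (by positivity) (hDVw.rpow hδ0 hqp) w3 ht0 (by rw [ht]; field_simp; ring)
      have w5 := (hb₁ _ _ (by positivity) (by fun_prop)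
        (w4.const_mul (c := p * q) (by positivity))).mono h2
      convert w5 using 1
      rw [Real.mul_rpow hC₂.le (by positivity), ← Real.rpow_mul hB.le, mul_one_div_cancel hp0.ne',
        Real.rpow_one]
      calc B / 2 = (1 / 2) * B := by ring
        _ = _ := by rw [← hδM, hM]; ring
  -- Vanishing a.e. becomes vanishing everywhere, because the bounds by potentials hold at every
  -- point.
  have hgV0 : ∀ x, gV x = 0 := by
    intro x
    have h3 : potential α σ₂ (fun y => gU y ^ p) x = 0 := by
      rw [potential_congr_ae (G := fun _ => 0), potential_zero]
      filter_upwards [hae] with y hy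
      rw [hy, Pi.zero_apply, ENNReal.zero_rpow_of_pos hp0]
    have := h1 x
    rwa [h3, ENNReal.zero_rpow_of_pos (by positivity), nonpos_iff_eq_zero] at this
  have hgU0 : ∀ x, gU x = 0 := by
    intro x
    have := h2 x
    simpa [hgV0, potential_zero] using this
  intro x hx
  have hu := hgU0 x
  have hv := hgV0 x
  rw [hgU, Set.indicator_of_mem hx, tsub_eq_zero_iff_le] at hu
  rw [hgV, Set.indicator_of_mem hx, tsub_eq_zero_iff_le] at hv
  exact ⟨hu, (ENNReal.rpow_le_rpow_iff (by positivity)).1 hv⟩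

/-- Moving planes: if `U` and `V` have small norms where they exceed their reflections, they do not
exceed them at all. -/
theorem exists_small (d : SystemData n α p q σ₁ σ₂ a b U V) :
    ∃ ε : ℝ, 0 < ε ∧ ∀ (e : EuclideanSpace ℝ (Fin n)) (l : ℝ), ‖e‖ = 1 →
      (σ₁ = 0 ∨ 0 ≤ l) → (σ₂ = 0 ∨ 0 ≤ l) →
      ∫⁻ x in {y | y ∈ halfSpace e l ∧ U (planeRefl e l y) < U y}, U x ^ (n / a) ≤
        ENNReal.ofReal ε →
      ∫⁻ x in {y | y ∈ halfSpace e l ∧ V (planeRefl e l y) < V y}, V x ^ (n / b) ≤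
        ENNReal.ofReal ε →
      ∀ x ∈ halfSpace e l, U x ≤ U (planeRefl e l x) ∧ V x ≤ V (planeRefl e l x) := by
  rcases le_total 1 p with hp | hp
  · obtain ⟨ε, hε, h⟩ := d.exists_small_of_one_le hp
    exact ⟨ε, hε, fun e l he h1 h2 _ h4 => h e l he h1 h2 h4⟩
  · have hq : 1 ≤ q := by
      have := d.one_lt
      have := d.q_pos
      nlinarith
    obtain ⟨ε, hε, h⟩ := d.swap.exists_small_of_one_le hq
    exact ⟨ε, hε, fun e l he h1 h2 h3 _ x hx => (h e l he h2 h1 h3 x hx).symm⟩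

end SystemData

/-! ### Moving the planes. -/

/-- Continuity method: the supremum of the failures above `m` satisfies `Q` by closedness, and
openness then excludes failures just below it. -/
theorem forall_gt_of_open_of_closed {Q : ℝ → Prop} {m L : ℝ} (hL : ∀ l, L ≤ l → Q l)
    (hopen : ∀ l, m < l → Q l → ∃ δ, 0 < δ ∧ ∀ μ, l - δ < μ → μ < l → m < μ → Q μ)
    (hclosed : ∀ l, (∀ μ, l < μ → Q μ) → Q l) : ∀ l, m < l → Q l := by
  intro l₁ hl₁
  by_contra hQ
  set T : Set ℝ := {l | ¬ Q l ∧ m < l} with hT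
  have hne : T.Nonempty := ⟨l₁, hQ, hl₁⟩
  have hbdd : BddAbove T := ⟨L, fun l hl => by
    by_contra h
    exact hl.1 (hL l (not_le.1 h).le)⟩
  have hms : m < sSup T := hl₁.trans_le (le_csSup hbdd ⟨hQ, hl₁⟩)
  have habove : ∀ μ, sSup T < μ → Q μ := fun μ hμ => by
    by_contra h
    exact absurd (le_csSup hbdd ⟨h, hms.trans hμ⟩) (not_le.2 hμ)
  have hs := hclosed _ habove
  obtain ⟨δ, hδ, hb⟩ := hopen _ hms hs
  obtain ⟨μ, hμ, hlt⟩ := exists_lt_of_lt_csSup hne (show sSup T - δ < sSup T by linarith)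
  rcases (le_csSup hbdd hμ).eq_or_lt with h | h
  · rw [← h] at hs; exact hμ.1 hs
  · exact hμ.1 (hb μ hlt h hμ.2)

theorem volume_halfSpace_ne_zero {n : ℕ} {e : EuclideanSpace ℝ (Fin n)} (he : ‖e‖ = 1) (l : ℝ) :
    volume (halfSpace e l) ≠ 0 := by
  refine (isOpen_halfSpace.measure_pos volume ⟨(l + 1) • e, ?_⟩).ne'
  rw [mem_halfSpace, real_inner_smul_left, real_inner_self_eq_norm_sq, he]
  linarith

theorem exists_mem_halfSpace_of_ae {n : ℕ} {e : EuclideanSpace ℝ (Fin n)} (he : ‖e‖ = 1) (l : ℝ)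
    {P : EuclideanSpace ℝ (Fin n) → Prop} (h : ∀ᵐ y, y ∈ halfSpace e l → P y) :
    ∃ y ∈ halfSpace e l, P y := by
  by_contra hcon
  push Not at hcon
  refine volume_halfSpace_ne_zero he l (measure_mono_null (fun y hy => ?_) (ae_iff.1 h))
  simp only [Set.mem_ofPred_eq]
  exact fun h' => hcon y hy (h' hy)

/-- On the half-space `⟪x, e⟫ > l`, neither `U` nor `V` exceeds its reflection. -/
def ReflLE {n : ℕ} (U V : EuclideanSpace ℝ (Fin n) → ℝ≥0∞) (e : EuclideanSpace ℝ (Fin n))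
    (l : ℝ) : Prop :=
  ∀ x ∈ halfSpace e l, U x ≤ U (planeRefl e l x) ∧ V x ≤ V (planeRefl e l x)

/-- On the half-space `⟪x, e⟫ > l`, both `U` and `V` are smaller than their reflections. -/
def ReflLT {n : ℕ} (U V : EuclideanSpace ℝ (Fin n) → ℝ≥0∞) (e : EuclideanSpace ℝ (Fin n))
    (l : ℝ) : Prop :=
  ∀ x ∈ halfSpace e l, U x < U (planeRefl e l x) ∧ V x < V (planeRefl e l x)

/-- `U` and `V` are symmetric with respect to the hyperplane `⟪x, e⟫ = l`. -/
def ReflEq {n : ℕ} (U V : EuclideanSpace ℝ (Fin n) → ℝ≥0∞) (e : EuclideanSpace ℝ (Fin n))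
    (l : ℝ) : Prop :=
  ∀ x, U (planeRefl e l x) = U x ∧ V (planeRefl e l x) = V x

theorem ReflLE.swap {n : ℕ} {U V : EuclideanSpace ℝ (Fin n) → ℝ≥0∞}
    {e : EuclideanSpace ℝ (Fin n)} {l : ℝ} (h : ReflLE U V e l) : ReflLE V U e l :=
  fun x hx => (h x hx).symm

namespace SystemData

variable {n : ℕ} {α p q σ₁ σ₂ a b : ℝ} {U V : EuclideanSpace ℝ (Fin n) → ℝ≥0∞}
  {e : EuclideanSpace ℝ (Fin n)} {l : ℝ}

theorem exists_nat_setLIntegral_halfSpace_le (d : SystemData n α p q σ₁ σ₂ a b U V)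
    (e : EuclideanSpace ℝ (Fin n)) {ε : ℝ} (hε : 0 < ε) :
    ∃ N : ℕ, ∫⁻ x in halfSpace e N, U x ^ (n / a) ≤ ENNReal.ofReal ε := by
  have h := tendsto_setLIntegral_zero_of_ae (d.measurable_U.pow_const (n / a)) d.int_U
    (D := fun k : ℕ => halfSpace e k) (fun k => measurableSet_halfSpace)
    (Eventually.of_forall fun x => by
      obtain ⟨N, hN⟩ := exists_nat_gt (inner ℝ x e)
      filter_upwards [eventually_ge_atTop N] with k hk
      rw [mem_halfSpace, not_lt]
      exact hN.le.trans (by exact_mod_cast hk))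
  exact (h.eventually_le_const (ENNReal.ofReal_pos.2 hε)).exists

theorem exists_reflLE_of_ge (d : SystemData n α p q σ₁ σ₂ a b U V) (he : ‖e‖ = 1) :
    ∃ L : ℝ, ∀ l, L ≤ l → ReflLE U V e l := by
  obtain ⟨ε, hε, h⟩ := d.exists_small
  obtain ⟨N₁, h₁⟩ := d.exists_nat_setLIntegral_halfSpace_le e hε
  obtain ⟨N₂, h₂⟩ := d.swap.exists_nat_setLIntegral_halfSpace_le e hε
  refine ⟨max N₁ N₂, fun l hl => ?_⟩
  have hl₁ : (N₁ : ℝ) ≤ l := (le_max_left _ _).trans hl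
  have hl₂ : (N₂ : ℝ) ≤ l := (le_max_right _ _).trans hl
  have hl0 : 0 ≤ l := le_trans (by positivity) hl₁
  refine h e l he (Or.inr hl0) (Or.inr hl0) (le_trans (lintegral_mono_set fun x hx => ?_) h₁)
    (le_trans (lintegral_mono_set fun x hx => ?_) h₂)
  · exact hl₁.trans_lt hx.1
  · exact hl₂.trans_lt hx.1

/-- Fix the reflected point `x'` of `x` and reflect it back in nearby hyperplanes `μ > l`. The
resulting points tend to `x` and have `U ≤ U x'`, so lower semicontinuity at `x` suffices. -/
theorem le_planeRefl_of_forall_gt (d : SystemData n α p q σ₁ σ₂ a b U V) (he : ‖e‖ = 1)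
    (h : ∀ μ, l < μ → ReflLE U V e μ) : ∀ x ∈ halfSpace e l, U x ≤ U (planeRefl e l x) := by
  intro x hx
  by_contra hcon
  push Not at hcon
  have hev := d.lowerSemicontinuous_U x _ hcon
  have hcont : Continuous fun μ => planeRefl e μ (planeRefl e l x) := by
    unfold planeRefl; fun_prop
  have hlim : Tendsto (fun μ => planeRefl e μ (planeRefl e l x)) (𝓝[>] l) (𝓝 x) := by
    have := (hcont.tendsto l).mono_left (nhdsWithin_le_nhds (s := Set.Ioi l))
    rwa [planeRefl_planeRefl he] at this
  obtain ⟨μ, hμ, hlt⟩ := ((hlim.eventually hev).and self_mem_nhdsWithin).exists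
  refine absurd hμ (not_lt.2 ?_)
  have := (h μ hlt (planeRefl e μ (planeRefl e l x)) (by
    rw [mem_halfSpace] at hx ⊢
    rw [inner_planeRefl he, inner_planeRefl he]
    linarith)).1
  rwa [planeRefl_planeRefl he] at this

theorem reflLE_of_forall_gt (d : SystemData n α p q σ₁ σ₂ a b U V) (he : ‖e‖ = 1)
    (h : ∀ μ, l < μ → ReflLE U V e μ) : ReflLE U V e l := fun x hx =>
  ⟨d.le_planeRefl_of_forall_gt he h x hx,
    d.swap.le_planeRefl_of_forall_gt he (fun μ hμ => (h μ hμ).swap) x hx⟩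

/-- Off the limiting hyperplane, strict inequality at `x` persists for nearby `μ` because `U` is
lower semicontinuous at the reflected point. So a.e. point eventually leaves the exceedance sets. -/
theorem tendsto_setLIntegral_exceed (d : SystemData n α p q σ₁ σ₂ a b U V) (he : ‖e‖ = 1)
    (h : ∀ x ∈ halfSpace e l, U x < U (planeRefl e l x)) {μ : ℕ → ℝ}
    (hμ : Tendsto μ atTop (𝓝 l)) :
    Tendsto (fun k => ∫⁻ x in {y | y ∈ halfSpace e (μ k) ∧ U (planeRefl e (μ k) y) < U y},
      U x ^ (n / a)) atTop (𝓝 0) := by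
  have hUm := d.measurable_U
  refine tendsto_setLIntegral_zero_of_ae (hUm.pow_const (n / a)) d.int_U
    (D := fun k => {y | y ∈ halfSpace e (μ k) ∧ U (planeRefl e (μ k) y) < U y})
    (fun k => measurableSet_halfSpace.inter (measurableSet_lt (by fun_prop) hUm)) ?_
  have hne : ∀ᵐ x : EuclideanSpace ℝ (Fin n), inner ℝ x e ≠ l := by
    rw [ae_iff]; simpa using volume_hyperplane (l := l) he
  filter_upwards [hne] with x hx
  rcases lt_or_gt_of_ne hx with hlt | hgt
  · filter_upwards [hμ.eventually_const_lt hlt] with k hk hmem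
    exact absurd hmem.1 (not_lt.2 hk.le)
  · have hcont : Continuous fun μ => planeRefl e μ x := by
      unfold planeRefl; fun_prop
    have hlim : Tendsto (fun k => planeRefl e (μ k) x) atTop (𝓝 (planeRefl e l x)) :=
      (hcont.tendsto l).comp hμ
    filter_upwards [hlim.eventually (d.lowerSemicontinuous_U _ _ (h x hgt))] with k hk hmem
    exact absurd hmem.2 (not_lt.2 hk.le)

theorem exists_reflLE_of_reflLT (d : SystemData n α p q σ₁ σ₂ a b U V) (he : ‖e‖ = 1)
    (h : ReflLT U V e l) : ∃ δ : ℝ, 0 < δ ∧ ∀ μ, l - δ < μ → μ < l →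
      (σ₁ = 0 ∨ 0 ≤ μ) → (σ₂ = 0 ∨ 0 ≤ μ) → ReflLE U V e μ := by
  obtain ⟨ε, hε, hsmall⟩ := d.exists_small
  by_contra hcon
  push Not at hcon
  choose μ h1 h2 h3 h4 h5 using fun k : ℕ => hcon (1 / ((k : ℝ) + 1)) (by positivity)
  have hμ : Tendsto μ atTop (𝓝 l) := by
    refine tendsto_of_tendsto_of_tendsto_of_le_of_le (g := fun k : ℕ => l - 1 / ((k : ℝ) + 1))
      (h := fun _ => l) ?_ tendsto_const_nhds (fun k => (h1 k).le) (fun k => (h2 k).le)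
    simpa using tendsto_one_div_add_atTop_nhds_zero_nat.const_sub l
  have t1 := d.tendsto_setLIntegral_exceed he (fun x hx => (h x hx).1) hμ
  have t2 := d.swap.tendsto_setLIntegral_exceed he (fun x hx => (h x hx).2) hμ
  obtain ⟨k, hk1, hk2⟩ := ((t1.eventually_le_const (ENNReal.ofReal_pos.2 hε)).and
    (t2.eventually_le_const (ENNReal.ofReal_pos.2 hε))).exists
  exact h5 k (hsmall e (μ k) he (h3 k) (h4 k) hk1 hk2)

theorem ae_eq_of_not_lt (d : SystemData n α p q σ₁ σ₂ a b U V) (he : ‖e‖ = 1)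
    (hl : σ₂ = 0 ∨ 0 ≤ l) (h : ReflLE U V e l) {x : EuclideanSpace ℝ (Fin n)}
    (hx : x ∈ halfSpace e l) (hlt : ¬ V x < V (planeRefl e l x)) :
    ∀ᵐ y : EuclideanSpace ℝ (Fin n), y ∈ halfSpace e l →
      wt σ₂ y * U y ^ p = wt σ₂ (planeRefl e l y) * U (planeRefl e l y) ^ p := by
  refine ae_eq_of_potential_eq he d.α_lt d.σ₂_nonneg hl (F := fun y => U y ^ p)
    (d.measurable_U.pow_const p)
    (fun y => ENNReal.rpow_ne_top_of_nonneg d.p_pos.le (d.U_ne_top y))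
    (fun y hy => ENNReal.rpow_le_rpow (h y hy).1 d.p_pos.le) hx ?_ ?_
  · rw [← d.eq_V]; exact d.V_ne_top x
  · rw [← d.eq_V, ← d.eq_V]; exact not_lt.1 hlt

theorem lt_of_σ₂_pos (d : SystemData n α p q σ₁ σ₂ a b U V) (he : ‖e‖ = 1) (hσ : 0 < σ₂)
    (hl : 0 < l) (h : ReflLE U V e l) : ∀ x ∈ halfSpace e l, V x < V (planeRefl e l x) := by
  intro x hx
  by_contra hlt
  have := d.neZero
  obtain ⟨y, hy, h0, heq⟩ := exists_mem_halfSpace_of_ae he l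
    (P := fun y => planeRefl e l y ≠ 0 ∧
      wt σ₂ y * U y ^ p = wt σ₂ (planeRefl e l y) * U (planeRefl e l y) ^ p) (by
    filter_upwards [d.ae_eq_of_not_lt he (Or.inr hl.le) h hx hlt, ae_planeRefl_ne_zero he]
      with y h1 h2 h3
    exact ⟨h2, h1 h3⟩)
  refine absurd heq (ne_of_lt ?_)
  calc wt σ₂ y * U y ^ p ≤ wt σ₂ y * U (planeRefl e l y) ^ p := by
        gcongr
        · exact d.p_pos.le
        · exact (h y hy).1
    _ < _ := by
        refine ENNReal.mul_lt_mul_left ?_ ?_ (wt_lt_wt_planeRefl he hσ hl hy h0)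
        · rw [Ne, ENNReal.rpow_eq_zero_iff_of_pos d.p_pos]; exact d.U_ne_zero _
        · exact ENNReal.rpow_ne_top_of_nonneg d.p_pos.le (d.U_ne_top _)

theorem ae_eq_of_not_lt_of_σ₂_eq_zero (d : SystemData n α p q σ₁ σ₂ a b U V) (he : ‖e‖ = 1)
    (hσ : σ₂ = 0) (h : ReflLE U V e l) {x : EuclideanSpace ℝ (Fin n)}
    (hx : x ∈ halfSpace e l) (hlt : ¬ V x < V (planeRefl e l x)) :
    ∀ᵐ y : EuclideanSpace ℝ (Fin n), y ∈ halfSpace e l → U y = U (planeRefl e l y) := by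
  filter_upwards [d.ae_eq_of_not_lt he (Or.inl hσ) h hx hlt] with y hy hyH
  have := hy hyH
  subst hσ
  rw [wt_zero, wt_zero, one_mul, one_mul] at this
  exact ENNReal.rpow_left_injective d.p_pos.ne' this

theorem lt_of_σ_pos (d : SystemData n α p q σ₁ σ₂ a b U V) (he : ‖e‖ = 1)
    (hσ : 0 < σ₁ ∨ 0 < σ₂) (hl : 0 < l) (h : ReflLE U V e l) :
    ∀ x ∈ halfSpace e l, V x < V (planeRefl e l x) := by
  rcases d.σ₂_nonneg.eq_or_lt with h2 | h2
  · have h1 : 0 < σ₁ := hσ.resolve_right (by rw [← h2]; exact lt_irrefl 0)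
    intro x hx
    by_contra hlt
    -- With `σ₂ = 0`, failure for `V` makes `U` equal to its reflection a.e., while the positive
    -- `σ₁` makes `U` strictly smaller.
    obtain ⟨y, hy, heq⟩ := exists_mem_halfSpace_of_ae he l
      (d.ae_eq_of_not_lt_of_σ₂_eq_zero he h2.symm h hx hlt)
    exact (d.swap.lt_of_σ₂_pos he h1 hl h.swap y hy).ne heq
  · exact d.lt_of_σ₂_pos he h2 hl h

theorem reflLT_of_σ_pos (d : SystemData n α p q σ₁ σ₂ a b U V) (he : ‖e‖ = 1)
    (hσ : 0 < σ₁ ∨ 0 < σ₂) (hl : 0 < l) (h : ReflLE U V e l) : ReflLT U V e l := fun x hx =>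
  ⟨d.swap.lt_of_σ_pos he hσ.symm hl h.swap x hx, d.lt_of_σ_pos he hσ hl h x hx⟩

theorem eq_planeRefl_of_ae_eq (d : SystemData n α p q σ₁ σ₂ a b U V) (he : ‖e‖ = 1)
    (hσ : σ₂ = 0) (h : ∀ᵐ y : EuclideanSpace ℝ (Fin n), y ∈ halfSpace e l →
      U y = U (planeRefl e l y)) (x : EuclideanSpace ℝ (Fin n)) :
    V (planeRefl e l x) = V x := by
  have hF := d.measurable_U.pow_const p
  rw [d.eq_V, d.eq_V, potential_planeRefl_eq_halfSpace he hF, potential_eq_halfSpace (l := l) he hF]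
  refine lintegral_congr_ae ?_
  filter_upwards [(ae_restrict_iff' measurableSet_halfSpace).2 h] with y hy
  subst hσ
  rw [wt_zero, wt_zero, ← hy, add_comm]

theorem reflEq_of_not_lt (d : SystemData n α p q σ₁ σ₂ a b U V) (he : ‖e‖ = 1)
    (hσ₁ : σ₁ = 0) (hσ₂ : σ₂ = 0) (h : ReflLE U V e l) {x : EuclideanSpace ℝ (Fin n)}
    (hx : x ∈ halfSpace e l) (hlt : ¬ V x < V (planeRefl e l x)) : ReflEq U V e l := by
  have hV := d.eq_planeRefl_of_ae_eq he hσ₂ (d.ae_eq_of_not_lt_of_σ₂_eq_zero he hσ₂ h hx hlt)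
  have hU := d.swap.eq_planeRefl_of_ae_eq (l := l) he hσ₁
    (Eventually.of_forall fun y _ => (hV y).symm)
  exact fun x => ⟨hU x, hV x⟩

theorem reflLT_or_reflEq (d : SystemData n α p q σ₁ σ₂ a b U V) (he : ‖e‖ = 1)
    (hσ₁ : σ₁ = 0) (hσ₂ : σ₂ = 0) (h : ReflLE U V e l) : ReflLT U V e l ∨ ReflEq U V e l := by
  by_cases hV : ∃ x ∈ halfSpace e l, ¬ V x < V (planeRefl e l x)
  · obtain ⟨x, hx, hlt⟩ := hV
    exact Or.inr (d.reflEq_of_not_lt he hσ₁ hσ₂ h hx hlt)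
  by_cases hU : ∃ x ∈ halfSpace e l, ¬ U x < U (planeRefl e l x)
  · obtain ⟨x, hx, hlt⟩ := hU
    exact Or.inr fun y => (d.swap.reflEq_of_not_lt he hσ₂ hσ₁ h.swap hx hlt y).symm
  push Not at hU hV
  exact Or.inl fun x hx => ⟨hU x hx, hV x hx⟩

theorem reflLE_of_σ_pos (d : SystemData n α p q σ₁ σ₂ a b U V) (he : ‖e‖ = 1)
    (hσ : 0 < σ₁ ∨ 0 < σ₂) : ∀ l, 0 < l → ReflLE U V e l := by
  obtain ⟨L, hL⟩ := d.exists_reflLE_of_ge he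
  refine forall_gt_of_open_of_closed hL (fun l hl hQ => ?_) (fun l h => d.reflLE_of_forall_gt he h)
  obtain ⟨δ, hδ, h⟩ := d.exists_reflLE_of_reflLT he (d.reflLT_of_σ_pos he hσ hl hQ)
  exact ⟨δ, hδ, fun μ h1 h2 h3 => h μ h1 h2 (Or.inr h3.le) (Or.inr h3.le)⟩

theorem reflEq_of_reflLE_neg (he : ‖e‖ = 1) (h : ReflLE U V e l) (h' : ReflLE U V (-e) (-l)) :
    ReflEq U V e l := by
  have key : ∀ x ∈ halfSpace e l, U (planeRefl e l x) = U x ∧ V (planeRefl e l x) = V x := by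
    intro x hx
    have h1 := h x hx
    have h2 := h' (planeRefl e l x) ((planeRefl_mem_halfSpace_neg he).2 hx)
    rw [planeRefl_neg, planeRefl_planeRefl he] at h2
    exact ⟨le_antisymm h2.1 h1.1, le_antisymm h2.2 h1.2⟩
  intro x
  rcases lt_trichotomy (inner ℝ x e) l with hlt | heq | hgt
  · have := key (planeRefl e l x) (by rw [mem_halfSpace, inner_planeRefl he]; linarith)
    rw [planeRefl_planeRefl he] at this
    exact ⟨this.1.symm, this.2.symm⟩
  · rw [planeRefl_of_inner_eq heq]; exact ⟨rfl, rfl⟩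
  · exact key x hgt

/-! ### Hyperplanes of symmetry and the common centre. -/

theorem exists_reflEq (d : SystemData n α p q σ₁ σ₂ a b U V) (he : ‖e‖ = 1)
    (hσ₁ : σ₁ = 0) (hσ₂ : σ₂ = 0) : ∃ l, ReflEq U V e l := by
  by_contra hcon
  push Not at hcon
  obtain ⟨L, hL⟩ := d.exists_reflLE_of_ge he
  obtain ⟨L', hL'⟩ := d.exists_reflLE_of_ge (e := -e) (by rwa [norm_neg])
  -- If no position is symmetric, the plane never stops and passes `-L'`, where the plane from the
  -- opposite direction gives the reverse inequality. The margin `1` puts `-L'` strictly inside the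
  -- range.
  have hall := forall_gt_of_open_of_closed (m := -L' - 1) hL (fun l hl hQ => by
    obtain ⟨δ, hδ, h⟩ := d.exists_reflLE_of_reflLT he
      ((d.reflLT_or_reflEq he hσ₁ hσ₂ hQ).resolve_right (hcon l))
    exact ⟨δ, hδ, fun μ h1 h2 h3 => h μ h1 h2 (Or.inl hσ₁) (Or.inl hσ₂)⟩)
    (fun l h => d.reflLE_of_forall_gt he h)
  exact hcon (-L') (reflEq_of_reflLE_neg he (hall _ (by linarith))
    (hL' _ (by rw [neg_neg])))

/-- A period would make the integral over the half-spaces at `k * τ` independent of `k`, although it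
tends to zero. -/
theorem not_translation_invariant (d : SystemData n α p q σ₁ σ₂ a b U V) (he : ‖e‖ = 1) {τ : ℝ}
    (hτ : 0 < τ) (h : ∀ x, U (x + τ • e) = U x) : False := by
  have hUm := d.measurable_U.pow_const (n / a)
  have hstep : ∀ l : ℝ, ∫⁻ x in halfSpace e (l + τ), U x ^ (n / a) =
      ∫⁻ x in halfSpace e l, U x ^ (n / a) := by
    intro l
    rw [← (measurePreserving_add_right volume (τ • e)).setLIntegral_comp_preimage
      measurableSet_halfSpace hUm]
    simp only [h]
    congr 2
    ext x
    rw [Set.mem_preimage, mem_halfSpace, mem_halfSpace, inner_add_left, real_inner_smul_left,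
      real_inner_self_eq_norm_sq, he]
    constructor <;> intro h <;> linarith
  have hall : ∀ k : ℕ, ∫⁻ x in halfSpace e (k * τ), U x ^ (n / a) =
      ∫⁻ x in halfSpace e 0, U x ^ (n / a) := by
    intro k
    induction k with
    | zero => simp
    | succ k ih => rw [← ih, ← hstep (k * τ)]; congr 3; push_cast; ring
  have hlim := tendsto_setLIntegral_zero_of_ae hUm d.int_U
    (D := fun k : ℕ => halfSpace e (k * τ)) (fun k => measurableSet_halfSpace)
    (Eventually.of_forall fun x => by
      obtain ⟨N, hN⟩ := exists_nat_gt (inner ℝ x e / τ)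
      filter_upwards [eventually_ge_atTop N] with k hk
      rw [mem_halfSpace, not_lt]
      rw [div_lt_iff₀ hτ] at hN
      have : (N : ℝ) ≤ k := by exact_mod_cast hk
      nlinarith)
  simp only [hall] at hlim
  have h0 := tendsto_nhds_unique tendsto_const_nhds hlim
  rw [setLIntegral_eq_zero_iff measurableSet_halfSpace hUm] at h0
  obtain ⟨y, -, hy⟩ := exists_mem_halfSpace_of_ae he 0 h0
  rw [ENNReal.rpow_eq_zero_iff_of_pos (div_pos d.n_pos d.a_pos)] at hy
  exact d.U_ne_zero y hy

theorem not_lt_of_reflEq (d : SystemData n α p q σ₁ σ₂ a b U V) (he : ‖e‖ = 1) {l' : ℝ}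
    (h : ReflEq U V e l) (h' : ReflEq U V e l') : ¬ l < l' := by
  intro hlt
  refine d.not_translation_invariant he (τ := 2 * (l' - l)) (by linarith) fun x => ?_
  rw [← (h x).1, ← (h' (planeRefl e l x)).1]
  congr 1
  conv_rhs => rw [planeRefl, inner_planeRefl he, planeRefl]
  module

theorem reflEq_unique (d : SystemData n α p q σ₁ σ₂ a b U V) (he : ‖e‖ = 1) {l' : ℝ}
    (h : ReflEq U V e l) (h' : ReflEq U V e l') : l = l' :=
  le_antisymm (not_lt.1 (d.not_lt_of_reflEq he h' h)) (not_lt.1 (d.not_lt_of_reflEq he h h'))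

theorem reflLT_of_gt (d : SystemData n α p q σ₁ σ₂ a b U V) (he : ‖e‖ = 1)
    (hσ₁ : σ₁ = 0) (hσ₂ : σ₂ = 0) (h : ReflEq U V e l) : ∀ μ, l < μ → ReflLT U V e μ := by
  have hLT : ∀ μ, l < μ → ReflLE U V e μ → ReflLT U V e μ := fun μ hμ hQ =>
    (d.reflLT_or_reflEq he hσ₁ hσ₂ hQ).resolve_right fun h' => d.not_lt_of_reflEq he h h' hμ
  obtain ⟨L, hL⟩ := d.exists_reflLE_of_ge he
  have hall := forall_gt_of_open_of_closed (m := l) hL (fun μ hμ hQ => by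
    obtain ⟨δ, hδ, h⟩ := d.exists_reflLE_of_reflLT he (hLT μ hμ hQ)
    exact ⟨δ, hδ, fun μ h1 h2 h3 => h μ h1 h2 (Or.inl hσ₁) (Or.inl hσ₂)⟩)
    (fun l h => d.reflLE_of_forall_gt he h)
  exact fun μ hμ => hLT μ hμ (hall μ hμ)

/-- The coordinate symmetries compose to the point reflection in `c`. It carries any hyperplane of
symmetry to a parallel one, so uniqueness puts `c` on it. -/
theorem exists_center_of_σ_eq_zero (d : SystemData n α p q σ₁ σ₂ a b U V)
    (hσ₁ : σ₁ = 0) (hσ₂ : σ₂ = 0) : ∃ c : EuclideanSpace ℝ (Fin n), ∀ e, ‖e‖ = 1 →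
      ReflEq U V e (inner ℝ c e) := by
  choose L hL using fun i : Fin n => d.exists_reflEq (e := EuclideanSpace.single i 1) (by simp)
    hσ₁ hσ₂
  set c : EuclideanSpace ℝ (Fin n) := WithLp.toLp 2 L with hc
  have hs : ∀ (s : Finset (Fin n)) (x : EuclideanSpace ℝ (Fin n)),
      U (WithLp.toLp 2 fun i => if i ∈ s then 2 * c i - x i else x i) = U x ∧
      V (WithLp.toLp 2 fun i => if i ∈ s then 2 * c i - x i else x i) = V x := by
    intro s
    induction s using Finset.induction_on with
    | empty => intro x; simp
    | insert j s hj ih =>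
      intro x
      have e1 := ih x
      have e2 := hL j (WithLp.toLp 2 fun i => if i ∈ s then 2 * c i - x i else x i)
      rw [e1.1, e1.2] at e2
      convert e2 using 3 <;>
      · ext i
        simp only [planeRefl, PiLp.sub_apply, PiLp.smul_apply, PiLp.single_apply,
          EuclideanSpace.inner_single_right, Finset.mem_insert, smul_eq_mul]
        by_cases hij : i = j
        · subst hij; simp [hj, hc]; ring
        · simp [hij]
  have hpt : ∀ x, U ((2 : ℝ) • c - x) = U x ∧ V ((2 : ℝ) • c - x) = V x := by
    intro x
    convert hs Finset.univ x using 3 <;>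
    · ext i; simp
  refine ⟨c, fun e he => ?_⟩
  obtain ⟨l, hl⟩ := d.exists_reflEq he hσ₁ hσ₂
  have hl' : ReflEq U V e (2 * inner ℝ c e - l) := by
    intro x
    have e1 : planeRefl e (2 * inner ℝ c e - l) x =
        (2 : ℝ) • c - planeRefl e l ((2 : ℝ) • c - x) := by
      rw [planeRefl, planeRefl, inner_sub_left, real_inner_smul_left]; module
    rw [e1, (hpt _).1, (hpt _).2, (hl _).1, (hl _).2]
    exact hpt x
  have := d.reflEq_unique he hl hl'
  rwa [show inner ℝ c e = l by linarith]

/-- There is a centre such that `U` and `V` are symmetric with respect to all hyperplanes through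
it, and increase when they are reflected in a hyperplane towards it. -/
theorem exists_center (d : SystemData n α p q σ₁ σ₂ a b U V) :
    ∃ c : EuclideanSpace ℝ (Fin n), ((0 < σ₁ ∨ 0 < σ₂) → c = 0) ∧ ∀ e, ‖e‖ = 1 →
      ReflEq U V e (inner ℝ c e) ∧ ∀ l, inner ℝ c e < l → ReflLT U V e l := by
  by_cases hσ : 0 < σ₁ ∨ 0 < σ₂
  · refine ⟨0, fun _ => rfl, fun e he => ?_⟩
    have he' : ‖-e‖ = 1 := by rwa [norm_neg]
    rw [inner_zero_left]
    refine ⟨reflEq_of_reflLE_neg he (d.reflLE_of_forall_gt he (d.reflLE_of_σ_pos he hσ)) ?_,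
      fun l hl => d.reflLT_of_σ_pos he hσ hl (d.reflLE_of_σ_pos he hσ l hl)⟩
    rw [neg_zero]
    exact d.reflLE_of_forall_gt he' (d.reflLE_of_σ_pos he' hσ)
  · have h1 : σ₁ = 0 := le_antisymm (not_lt.1 fun h => hσ (Or.inl h)) d.σ₁_nonneg
    have h2 : σ₂ = 0 := le_antisymm (not_lt.1 fun h => hσ (Or.inr h)) d.σ₂_nonneg
    obtain ⟨c, hc⟩ := d.exists_center_of_σ_eq_zero h1 h2
    exact ⟨c, fun h => absurd h hσ, fun e he =>
      ⟨hc e he, d.reflLT_of_gt he h1 h2 (hc e he)⟩⟩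

end SystemData

/-! ### From reflections to radial symmetry and monotonicity. -/

section Geometry

variable {n : ℕ} {f : EuclideanSpace ℝ (Fin n) → ℝ} {c : EuclideanSpace ℝ (Fin n)}

theorem isRadialAbout_of_planeRefl
    (h : ∀ e, ‖e‖ = 1 → ∀ x, f (planeRefl e (inner ℝ c e) x) = f x) : IsRadialAbout c f := by
  intro x y hxy
  by_cases hne : x = y
  · rw [hne]
  have hpos : 0 < ‖x - y‖ := norm_pos_iff.2 (sub_ne_zero.2 hne)
  -- The perpendicular bisector of `x` and `y` passes through `c`, as they are equidistant from it.
  set e := ‖x - y‖⁻¹ • (x - y) with he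
  have he1 : ‖e‖ = 1 := by
    rw [he, norm_smul, norm_inv, norm_norm, inv_mul_cancel₀ hpos.ne']
  rw [← h e he1 x]
  congr 1
  have h1 : 2 * inner ℝ (x - c) (x - y) = ‖x - y‖ ^ 2 := by
    have h2 : ‖y - c‖ ^ 2 = ‖x - c‖ ^ 2 - 2 * inner ℝ (x - c) (x - y) + ‖x - y‖ ^ 2 := by
      rw [← norm_sub_sq_real]; congr 2; abel
    rw [hxy] at h2
    linarith
  rw [planeRefl, ← inner_sub_left, he, real_inner_smul_right, smul_smul]
  have : 2 * (‖x - y‖⁻¹ * inner ℝ (x - c) (x - y)) * ‖x - y‖⁻¹ = 1 := by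
    field_simp
    linarith
  rw [this, one_smul]
  abel

theorem isDecreasingAbout_of_planeRefl (hr : IsRadialAbout c f)
    (h : ∀ e, ‖e‖ = 1 → ∀ l, inner ℝ c e < l → ∀ x ∈ halfSpace e l, f x < f (planeRefl e l x)) :
    IsDecreasingAbout c f := by
  intro x y hxy
  have hpos : 0 < ‖y - c‖ := (norm_nonneg _).trans_lt hxy
  set e := ‖y - c‖⁻¹ • (y - c) with he
  have he1 : ‖e‖ = 1 := by
    rw [he, norm_smul, norm_inv, norm_norm, inv_mul_cancel₀ hpos.ne']
  have hy : y = c + ‖y - c‖ • e := by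
    rw [he, smul_smul, mul_inv_cancel₀ hpos.ne', one_smul]; abel
  have hye : inner ℝ y e = inner ℝ c e + ‖y - c‖ := by
    conv_lhs => rw [hy]
    rw [inner_add_left, real_inner_smul_left, real_inner_self_eq_norm_sq, he1]; ring
  -- This hyperplane reflects `y` to the point of its own ray from `c` at distance `‖x - c‖`; radial
  -- symmetry then replaces that point by `x`.
  set l := inner ℝ c e + (‖x - c‖ + ‖y - c‖) / 2 with hl
  have h1 := h e he1 l (by linarith [norm_nonneg (x - c)]) y (by
    rw [mem_halfSpace, hye]; linarith)
  have h2 : planeRefl e l y = c + ‖x - c‖ • e := by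
    have h3 : planeRefl e l y = y - (‖y - c‖ - ‖x - c‖) • e := by
      rw [planeRefl, hye, hl]; congr 2; ring
    rw [h3]
    nth_rewrite 1 [hy]
    clear_value e
    module
  rw [h2] at h1
  rwa [hr x (c + ‖x - c‖ • e) (by rw [add_sub_cancel_left, norm_smul, he1, norm_norm, mul_one])]

end Geometry

/-! ### Passage from real-valued solutions to `SystemData`. -/

theorem ofReal_kernelIntegrand {n : ℕ} {α σ m : ℝ} {w : EuclideanSpace ℝ (Fin n) → ℝ}
    (hw : ∀ x, 0 < w x) (x y : EuclideanSpace ℝ (Fin n)) :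
    ENNReal.ofReal (kernelIntegrand n α σ m w x y) =
      wt (n - α) (x - y) * wt σ y * ENNReal.ofReal (w y) ^ m := by
  have := hw y
  rw [kernelIntegrand, wt, wt, ENNReal.ofReal_rpow_of_pos this, ← ENNReal.ofReal_mul (by positivity),
    ← ENNReal.ofReal_mul (by positivity), div_eq_mul_inv, mul_inv, mul_comm]

theorem ofReal_integral_kernelIntegrand {n : ℕ} {α σ m : ℝ} {w : EuclideanSpace ℝ (Fin n) → ℝ}
    (hw : ∀ x, 0 < w x) {x : EuclideanSpace ℝ (Fin n)}
    (hi : Integrable (kernelIntegrand n α σ m w x) volume) :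
    ENNReal.ofReal (∫ y, kernelIntegrand n α σ m w x y) =
      potential α σ (fun y => ENNReal.ofReal (w y) ^ m) x := by
  rw [ofReal_integral_eq_lintegral_ofReal hi (Eventually.of_forall fun y => by
    have := hw y
    simp only [Pi.zero_apply, kernelIntegrand]; positivity)]
  exact lintegral_congr fun y => ofReal_kernelIntegrand hw x y

theorem lintegral_ofReal_rpow_ne_top {n : ℕ} {r : ℝ} (hr : 0 < r)
    {w : EuclideanSpace ℝ (Fin n) → ℝ} (hw : ∀ x, 0 < w x)
    (h : MemLp w (ENNReal.ofReal r) volume) : ∫⁻ x, ENNReal.ofReal (w x) ^ r ≠ ∞ := by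
  have := lintegral_rpow_enorm_lt_top_of_eLpNorm_lt_top (by simpa using hr) ENNReal.ofReal_ne_top
    h.eLpNorm_lt_top
  rw [ENNReal.toReal_ofReal hr.le] at this
  simpa only [Real.enorm_of_nonneg (hw _).le] using this.ne

theorem IsPositiveIntegrableSolution.systemData {n : ℕ} {α p q σ₁ σ₂ : ℝ}
    (hα : 0 < α) (hαn : α < (n : ℝ)) (hp : 0 < p) (hq : 0 < q) (hpq : 1 < p * q)
    (hσ₁ : 0 ≤ σ₁) (hσ₁α : σ₁ < α) (hσ₂ : 0 ≤ σ₂) (hσ₂α : σ₂ < α)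
    {u v : EuclideanSpace ℝ (Fin n) → ℝ}
    (huv : IsPositiveIntegrableSolution n α p q σ₁ σ₂ u v) :
    SystemData n α p q σ₁ σ₂ (q₀ α p q σ₁ σ₂) (p₀ α p q σ₁ σ₂)
      (fun x => ENNReal.ofReal (u x)) (fun x => ENNReal.ofReal (v x)) := by
  have hn : (0 : ℝ) < n := hα.trans hαn
  have : NeZero n := ⟨fun h => by rw [h] at hn; simp at hn⟩
  have hpq' : 0 < p * q - 1 := by linarith
  have hne := hpq'.ne'
  have hq₀ : 0 < q₀ α p q σ₁ σ₂ := div_pos (by nlinarith) hpq'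
  have hp₀ : 0 < p₀ α p q σ₁ σ₂ := div_pos (by nlinarith) hpq'
  have eU : ∀ x, ENNReal.ofReal (u x) =
      potential α σ₁ (fun y => ENNReal.ofReal (v y) ^ q) x := fun x => by
    rw [huv.eq_u, ofReal_integral_kernelIntegrand huv.pos_v (huv.integrable_u x)]
  have eV : ∀ x, ENNReal.ofReal (v x) =
      potential α σ₂ (fun y => ENNReal.ofReal (u y) ^ p) x := fun x => by
    rw [huv.eq_v, ofReal_integral_kernelIntegrand huv.pos_u (huv.integrable_v x)]
  refine
    { α_pos := hα
      α_lt := hαn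
      p_pos := hp
      q_pos := hq
      one_lt := hpq
      σ₁_nonneg := hσ₁
      σ₁_lt := hσ₁α
      σ₂_nonneg := hσ₂
      σ₂_lt := hσ₂α
      a_pos := hq₀
      b_pos := hp₀
      rel_a := by
        rw [q₀, p₀, add_sub_assoc, div_add' _ _ _ hne, mul_div_assoc', div_left_inj' hne]; ring
      rel_b := by
        rw [q₀, p₀, add_sub_assoc, div_add' _ _ _ hne, mul_div_assoc', div_left_inj' hne]; ring
      measurable_U := ?_
      measurable_V := ?_
      U_ne_zero := fun x => (ENNReal.ofReal_pos.2 (huv.pos_u x)).ne'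
      V_ne_zero := fun x => (ENNReal.ofReal_pos.2 (huv.pos_v x)).ne'
      U_ne_top := fun x => ENNReal.ofReal_ne_top
      V_ne_top := fun x => ENNReal.ofReal_ne_top
      eq_U := eU
      eq_V := eV
      int_U := lintegral_ofReal_rpow_ne_top (by positivity) huv.pos_u huv.memLp_u
      int_V := lintegral_ofReal_rpow_ne_top (by positivity) huv.pos_v huv.memLp_v }
  -- The integrability hypotheses give only a.e. measurability; the equation upgrades it, since a
  -- potential is lower semicontinuous and hence Borel.
  · rw [funext eU]
    exact (lowerSemicontinuous_potential
      (huv.memLp_v.aestronglyMeasurable.aemeasurable.ennreal_ofReal.pow_const q)).measurable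
  · rw [funext eV]
    exact (lowerSemicontinuous_potential
      (huv.memLp_u.aestronglyMeasurable.aemeasurable.ennreal_ofReal.pow_const p)).measurable

end HardySobolev

theorem mainTheorem3 (n : ℕ) (hn : 3 ≤ n) (α p q σ₁ σ₂ : ℝ)
    (hα : 0 < α) (hαn : α < (n : ℝ)) (hp : 0 < p) (hq : 0 < q) (hpq : 1 < p * q)
    (hσ₁ : 0 ≤ σ₁) (hσ₁α : σ₁ < α) (hσ₂ : 0 ≤ σ₂) (hσ₂α : σ₂ < α)
    (u v : EuclideanSpace ℝ (Fin n) → ℝ)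
    (huv : HardySobolev.IsPositiveIntegrableSolution n α p q σ₁ σ₂ u v) :
    ∃ c : EuclideanSpace ℝ (Fin n),
      ((0 < σ₁ ∨ 0 < σ₂) → c = 0) ∧
      HardySobolev.IsRadialAbout c u ∧ HardySobolev.IsDecreasingAbout c u ∧
      HardySobolev.IsRadialAbout c v ∧ HardySobolev.IsDecreasingAbout c v := by
  have d := huv.systemData hα hαn hp hq hpq hσ₁ hσ₁α hσ₂ hσ₂α
  obtain ⟨c, hc0, hc⟩ := d.exists_center
  have hu : HardySobolev.IsRadialAbout c u := HardySobolev.isRadialAbout_of_planeRefl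
    fun e he x => (ENNReal.ofReal_eq_ofReal_iff (huv.pos_u _).le (huv.pos_u _).le).1
      ((hc e he).1 x).1
  have hv : HardySobolev.IsRadialAbout c v := HardySobolev.isRadialAbout_of_planeRefl
    fun e he x => (ENNReal.ofReal_eq_ofReal_iff (huv.pos_v _).le (huv.pos_v _).le).1
      ((hc e he).1 x).2
  exact ⟨c, hc0, hu, HardySobolev.isDecreasingAbout_of_planeRefl hu fun e he l hl x hx =>
      (ENNReal.ofReal_lt_ofReal_iff (huv.pos_u _)).1 ((hc e he).2 l hl x hx).1,
    hv, HardySobolev.isDecreasingAbout_of_planeRefl hv fun e he l hl x hx =>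
      (ENNReal.ofReal_lt_ofReal_iff (huv.pos_v _)).1 ((hc e he).2 l hl x hx).2⟩
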